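/- Let $M$ be a smooth $n$-manifold, let $TM$ be its tangent bundle with projection $\pi$, let $\rho:TTM\to\pi^{-1}(TM)$ be induced by $d\pi$, let $\gamma:\pi^{-1}(TM)\to TTM$ be the vertical lift, $J=\gamma\circ\rho$, $\overline\eta(x,y)=y$ and $\mathcal C=\gamma\overline\eta$. Let $F$ be a (possibly conic) Finsler metric on an open conic subset $\mathcal D$ of the slit tangent bundle ($\mathcal D=TM\setminus 0$ in the regular case): $F\ge 0$ is smooth on $\mathcal D$, $\mathcal L_{\mathcal C}F=F$, and its metric tensor $g$ (the second fibre derivative of $E=\tfrac12F^2$, that is $g(\rho W,\rho Z)=dd_JE(JW,Z)$) is non-degenerate. Let $G$ be its geodesic spray: $G$ is smooth on $\mathcal D$, $JG=\mathcal C$, $[\mathcal C,G]=G$ and $i_G\,dd_JE=-dE$. Let $D^\circ$ be the Berwald connection of $F$, with horizontal map $\beta$ coming from the Barthel connection $\Gamma=[J,G]$. Let $\overline\varphi$ be a concurrent $\pi$-vector field: a smooth nowhere vanishing section of $\pi^{-1}(TM)$ over $\mathcal D$ such that, for all $\pi$-vector fields $\overline W$, one has $D^\circ_{\beta\overline W}\overline\varphi=-\overline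 W$ and $D^\circ_{\gamma\overline W}\overline\varphi=0$, and the associated $\pi$-form $\phi=g(\overline\varphi,\cdot)$ satisfies $D^\circ_{\gamma\overline W}\phi=0$. Put $\Phi=\phi(\overline\eta)$ and $\|\overline\varphi\|_g=g(\overline\varphi,\overline\varphi)$ (no square root). Let $m\in\mathbb R\setminus\{0,-1\}$ and let $\widehat{\mathcal D}\subseteq\mathcal D$ be an open conic subset on which $\Phi^{-m}$ is defined and smooth (at each point $\Phi>0$, or $m\in\mathbb Z$ and $\Phi\ne0$) and on which $mF^2\|\overline\varphi\|_g-(m-1)\Phi^2$ has no zero. Let $\widehat F=F^{m+1}\Phi^{-m}$ on $\widehat{\mathcal D}$. Then the geodesic spray $\widehat G$ of $\widehat F$ on $\widehat{\mathcal D}$ exists, is unique, and is $$\widehat G=G-\Psi_1\,\mathcal C+\Psi_2\,\gamma\overline\varphi,\qquad \Psi_1=\frac{2m\Phi F^2}{mF^2\|\overline\varphi\|_g-(m-1)\Phi^2},\qquad \Psi_2=\frac{mF^4}{mF^2\|\overline\varphi\|_g-(m-1)\Phi^2}.$$ -/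

import Mathlib

open scoped Manifold ContDiff

noncomputable section

namespace Finsler

/-- The model space of an `n`-dimensional manifold. -/
abbrev V (n : ℕ) : Type := EuclideanSpace ℝ (Fin n)

/-- The tangent bundle `TM`. -/
abbrev TB (n : ℕ) (M : Type*) [TopologicalSpace M] [ChartedSpace (V n) M]
    [IsManifold (𝓡 n) ∞ M] : Type _ :=
  TangentBundle (𝓡 n) M

variable {n : ℕ} {M : Type*} [TopologicalSpace M] [ChartedSpace (V n) M] [IsManifold (𝓡 n) ∞ M]

/-- A (rough) `π`-vector field: a section of the pullback bundle `π⁻¹(TM)` over `TM`.  It assigns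
to `p = (x, y) ∈ TM` a vector in `T_x M`. -/
abbrev PiField (n : ℕ) (M : Type*) [TopologicalSpace M] [ChartedSpace (V n) M]
    [IsManifold (𝓡 n) ∞ M] : Type _ :=
  ∀ p : TB n M, TangentSpace (𝓡 n) p.1

/-- A (rough) vector field on the manifold `TM`: a section of `TTM → TM`. -/
abbrev Field (n : ℕ) (M : Type*) [TopologicalSpace M] [ChartedSpace (V n) M]
    [IsManifold (𝓡 n) ∞ M] : Type _ :=
  ∀ p : TB n M, TangentSpace (𝓡 n).tangent p

/-- The `π`-vector field `ψ` is smooth on the set `U ⊆ TM`. -/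
def PiField.SmoothOn (ψ : PiField n M) (U : Set (TB n M)) : Prop :=
  ContMDiffOn (𝓡 n).tangent (𝓡 n).tangent ∞ (fun p : TB n M => (⟨p.1, ψ p⟩ : TB n M)) U

/-- The vector field `X` on `TM` is smooth on the set `U ⊆ TM`. -/
def Field.SmoothOn (X : Field n M) (U : Set (TB n M)) : Prop :=
  ContMDiffOn (𝓡 n).tangent (𝓡 n).tangent.tangent ∞
    (fun p : TB n M => (⟨p, X p⟩ : TangentBundle (𝓡 n).tangent (TB n M))) U

/-- The differential `df` of a function on `TM`, evaluated on a tangent vector at `p`. -/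
def dfun (f : TB n M → ℝ) (p : TB n M) (v : TangentSpace (𝓡 n).tangent p) : ℝ :=
  mfderiv (𝓡 n).tangent 𝓘(ℝ, ℝ) f p v

/-- The Lie bracket of vector fields on `TM`. -/
def bracket (X Y : Field n M) : Field n M :=
  VectorField.mlieBracket (𝓡 n).tangent X Y

/-- `ρ : TTM → π⁻¹(TM)`, the differential of the projection `π : TM → M`. -/
def rho (p : TB n M) :
    TangentSpace (𝓡 n).tangent p →L[ℝ] TangentSpace (𝓡 n) p.1 :=
  mfderiv (𝓡 n).tangent (𝓡 n) (fun q : TB n M => q.1) p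

/-- A tangent vector at `x`, seen in the model vector space of which `T_x M` is a type synonym. -/
def toModel {x : M} (v : TangentSpace (𝓡 n) x) : V n := v

/-- The inclusion of the fibre `T_x M` into `TM`. -/
def incl (x : M) (w : V n) : TB n M := ⟨x, (show TangentSpace (𝓡 n) x from w)⟩

/-- The natural injection `γ : π⁻¹(TM) → TTM` (vertical lift): the differential at `y` of the
inclusion of the fibre `T_x M` into `TM`. -/
def gam (p : TB n M) (v : TangentSpace (𝓡 n) p.1) : TangentSpace (𝓡 n).tangent p :=
  mfderiv 𝓘(ℝ, V n) (𝓡 n).tangent (incl p.1) (toModel p.2) (toModel v)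

/-- The tangent structure `J = γ ∘ ρ`, acting on vector fields. -/
def J (X : Field n M) : Field n M := fun p => gam p (rho p (X p))

/-- The Liouville vector field `𝒞 = γ η̄`, where `η̄ (x, y) = y`. -/
def liouville : Field n M := fun p => gam p p.2

/-- The `1`-form `d_J f = df ∘ J`, evaluated on a vector field. -/
def dJ (f : TB n M → ℝ) (X : Field n M) : TB n M → ℝ := fun p => dfun f p (J X p)

/-- The `2`-form `d d_J f`, evaluated on two vector fields. -/
def ddJ (f : TB n M → ℝ) (X Y : Field n M) : TB n M → ℝ := fun p =>
  dfun (dJ f Y) p (X p) - dfun (dJ f X) p (Y p) - dJ f (bracket X Y) p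

/-- The energy `E = F² / 2`. -/
def energy (F : TB n M → ℝ) : TB n M → ℝ := fun p => F p ^ 2 / 2

/-- The Finsler metric tensor at `p = (x, y)`: the second derivative of the energy along the fibre
`T_x M`, at `y`; it satisfies `g (ρ W) (ρ Z) = d d_J E (J W, Z)`. -/
def metric (F : TB n M → ℝ) (p : TB n M) (u v : TangentSpace (𝓡 n) p.1) : ℝ :=
  fderiv ℝ (fun w : V n => fderiv ℝ (fun w' : V n => energy F (incl p.1 w')) w (toModel v))
    (toModel p.2) (toModel u)

/-- Open conic subsets of the slit tangent bundle. -/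
structure IsConicDomain (D : Set (TB n M)) : Prop where
  isOpen : IsOpen D
  slit : ∀ p ∈ D, p.2 ≠ 0
  conic : ∀ p ∈ D, ∀ t : ℝ, 0 < t → (⟨p.1, t • p.2⟩ : TB n M) ∈ D

/-- `F` is a (conic) Finsler metric with domain `D`.  The regular Finsler metrics are the case in
which `D` is the whole slit tangent bundle. -/
structure IsFinsler (F : TB n M → ℝ) (D : Set (TB n M)) : Prop where
  domain : IsConicDomain D
  nonneg : ∀ p ∈ D, 0 ≤ F p
  smooth : ContMDiffOn (𝓡 n).tangent 𝓘(ℝ, ℝ) ∞ F D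
  homogeneous : ∀ p ∈ D, dfun F p (liouville p) = F p
  nondegenerate : ∀ p ∈ D, ∀ u : TangentSpace (𝓡 n) p.1, (∀ v, metric F p u v = 0) → u = 0

/-- `G` is a spray on `D`: a smooth vector field with `J G = 𝒞` and `[𝒞, G] = G`. -/
structure IsSpray (D : Set (TB n M)) (G : Field n M) : Prop where
  smooth : G.SmoothOn D
  tangent : ∀ p ∈ D, J G p = liouville p
  homogeneous : ∀ p ∈ D, bracket liouville G p = G p

/-- `G` is a geodesic spray of `F` on `D`: a spray with `i_G d d_J E = - dE`. -/
structure IsGeodesicSpray (F : TB n M → ℝ) (D : Set (TB n M)) (G : Field n M) : Prop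
    extends IsSpray D G where
  geodesic : ∀ U ⊆ D, IsOpen U → ∀ X : Field n M, X.SmoothOn U → ∀ p ∈ U,
    ddJ (energy F) G X p = - dfun (energy F) p (X p)

/-- The Barthel connection `Γ = [J, G]`, that is `Γ X = [J X, G] - J [X, G]`. -/
def barthel (G X : Field n M) : Field n M := fun p => bracket (J X) G p - J (bracket X G) p

/-- The horizontal projector `h = (I + Γ) / 2 = β ∘ ρ` of the Barthel connection. -/
def hor (G X : Field n M) : Field n M := fun p => (1 / 2 : ℝ) • (X p + barthel G X p)

/-- The vertical projector `v = (I - Γ) / 2 = γ ∘ K` of the Barthel connection. -/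
def ver (G X : Field n M) : Field n M := fun p => (1 / 2 : ℝ) • (X p - barthel G X p)

/-- The horizontal Berwald derivative: `berwaldH G X Y` is `γ (D°_{βρX} ρY) = v [h X, J Y]`. -/
def berwaldH (G X Y : Field n M) : Field n M := ver G (bracket (hor G X) (J Y))

/-- The vertical Berwald derivative: `berwaldV G X Y` is `D°_{γρX} ρY = ρ [J X, h Y]`. -/
def berwaldV (G X Y : Field n M) : PiField n M := fun p => rho p (bracket (J X) (hor G Y) p)

/-- `φ` is a concurrent `π`-vector field of the Finsler metric `F` with geodesic spray `G`:
it is smooth, vanishes nowhere, `D°_{βW} φ = - W` and `D°_{γW} φ = 0` for all `W`, and also the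
associated `π`-form `g(φ, ·)` is independent of the direction: `D°_{γW} (g(φ, ·)) = 0`. The
`π`-vector field `W` is written as `ρ X`, and `φ` as `ρ Y`, with local vector fields `X`, `Y`. -/
structure IsConcurrent (F : TB n M → ℝ) (D : Set (TB n M)) (G : Field n M)
    (φ : PiField n M) : Prop where
  smooth : φ.SmoothOn D
  ne_zero : ∀ p ∈ D, φ p ≠ 0
  horizontal : ∀ U ⊆ D, IsOpen U → ∀ X Y : Field n M, X.SmoothOn U → Y.SmoothOn U →
    (∀ p ∈ U, rho p (Y p) = φ p) → ∀ p ∈ U, berwaldH G X Y p = - J X p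
  vertical : ∀ U ⊆ D, IsOpen U → ∀ X Y : Field n M, X.SmoothOn U → Y.SmoothOn U →
    (∀ p ∈ U, rho p (Y p) = φ p) → ∀ p ∈ U, berwaldV G X Y p = 0
  vertical_form : ∀ U ⊆ D, IsOpen U → ∀ X Z : Field n M, X.SmoothOn U → Z.SmoothOn U →
    ∀ p ∈ U, dfun (fun q => metric F q (φ q) (rho q (Z q))) p (J X p)
      - metric F p (φ p) (berwaldV G X Z p) = 0

/-- The function `Φ = g(φ, η̄)`. -/
def Phi (F : TB n M → ℝ) (φ : PiField n M) : TB n M → ℝ := fun p => metric F p (φ p) p.2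

/-- `‖φ‖_g = g(φ, φ)` (without a square root). -/
def length (F : TB n M → ℝ) (φ : PiField n M) : TB n M → ℝ := fun p => metric F p (φ p) (φ p)

/-- The generalized Kropina change `F^{m+1} Φ^{-m}`. -/
def kropina (F : TB n M → ℝ) (φ : PiField n M) (m : ℝ) : TB n M → ℝ := fun p =>
  F p ^ (m + 1) * Phi F φ p ^ (-m)

/-- The function `m F² ‖φ‖_g - (m - 1) Φ²`. -/
def denom (F : TB n M → ℝ) (φ : PiField n M) (m : ℝ) : TB n M → ℝ := fun p =>
  m * F p ^ 2 * length F φ p - (m - 1) * Phi F φ p ^ 2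

/-- The function `Ψ₁`. -/
def Psi₁ (F : TB n M → ℝ) (φ : PiField n M) (m : ℝ) : TB n M → ℝ := fun p =>
  2 * m * Phi F φ p * F p ^ 2 / denom F φ m p

/-- The function `Ψ₂`. -/
def Psi₂ (F : TB n M → ℝ) (φ : PiField n M) (m : ℝ) : TB n M → ℝ := fun p =>
  m * F p ^ 4 / denom F φ m p

end Finsler

end

/-!
The argument is free of coordinates once a short calculus on `TM` is available: Lie brackets act on
functions as commutators, the Nijenhuis tensor of `J` vanishes (`bracket_J_J`), and
`[𝒞, J X] = J [𝒞, X] - J X` (`bracket_liouville_J`). For a function `f` on `TM` put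
`lagr f W X = W (J X f) - J [W, X] f`. For a vertical field `W` it is the Hessian of `f` along the
fibre (`hess_lie`), in particular the metric `g` when `f = E`. For a semispray `W`, the equation
`i_W d d_J f = - df` says that `lagr f W X = X f` for all `X`, provided that `𝒞 f = 2 f`
(`ddJ_spray`).

The Barthel connection is conservative, `dE (h X) = 0` (`dfun_energy_hor`). With `Φ = dE (γ φ)`, the
horizontal part of the concurrency condition gives `dΦ (h X) = - dE (J X)` (`dfun_Phi_hor`). Hence
`G Φ = - 2 E`, and `Φ` satisfies the Euler–Lagrange equation of `G` (`euler_lagrange_Phi`). The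
vertical part says that `φ` does not depend on the direction, so `dΦ (γ v) = g (φ, v)`
(`metric_eq_dfun_Phi`), and the condition on the form `g (φ, ·)` says that `Φ` has no second
derivative along the fibres (`hess_Phi`).

The energy of the changed metric is a constant times `E ^ (m + 1) * Φ ^ (-2 m)`, with logarithmic
derivative `(m + 1) dE / E - 2 m dΦ / Φ` (`dfun_energy_kropina`). For a semispray `G'`, write
`G' - G = γ u`; by the facts above, the equation `i_{G'} d d_J Ê = - d Ê` at a point becomes a linear
system for `u` which involves only `E`, `Φ` and the products of `u`, `y` and `φ` with arbitrary
vectors (`geodesic_kropina_iff`). Since `g` is non-degenerate, the system has exactly one solution,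
`u = - Ψ₁ y + Ψ₂ φ`, as soon as `m + 1`, `E`, `Φ` and the denominator are non-zero
(`linear_system_iff`); `E` is positive because a zero of `F` would be a degenerate point of the
metric (`IsFinsler.pos`). The resulting vector field is homogeneous of the right degree by Euler's
relations for `F`, `Φ` and `g (φ, φ)`, together with `[𝒞, γ φ] = - γ φ`.
-/

namespace Finsler

/-! ### Vector fields in charts -/

section Coordinates

open VectorField

variable {E H M W W' : Type*} [NormedAddCommGroup E] [NormedSpace ℝ E]
  [TopologicalSpace H] {I : ModelWithCorners ℝ E H} [TopologicalSpace M] [ChartedSpace H M]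
  [NormedAddCommGroup W] [NormedSpace ℝ W] [NormedAddCommGroup W'] [NormedSpace ℝ W']

variable (I) in
/-- The differential of a vector-valued function, with values in the vector space itself instead of
its tangent spaces. -/
noncomputable def der (f : M → W) (q : M) : TangentSpace I q →L[ℝ] W :=
  mfderiv I 𝓘(ℝ, W) f q

/-- The components of the vector field `X` in the chart at `c`. -/
noncomputable def coord (c : M) (X : ∀ q : M, TangentSpace I q) (q : M) : E :=
  der I (extChartAt I c) q (X q)

theorem two_le_infty : (2 : ℕ∞ω) ≤ ∞ :=
  WithTop.coe_le_coe.2 (le_top : (2 : ℕ∞) ≤ ⊤)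

/-- The chain rule for a function on the manifold followed by one of a vector variable. -/
theorem der_comp {f : M → W} {h : W → W'} {q : M} (hf : MDifferentiableAt I 𝓘(ℝ, W) f q)
    {h' : W →L[ℝ] W'} (hh : HasFDerivAt h h' (f q)) :
    der I (fun z => h (f z)) q = h'.comp (der I f q) :=
  (hh.hasMFDerivAt.comp q hf.hasMFDerivAt).mfderiv

theorem der_congr {f g : M → W} {q : M} (h : f =ᶠ[nhds q] g) : der I f q = der I g q :=
  h.mfderiv_eq

theorem der_const (w : W) (q : M) : der I (fun _ => w) q = 0 :=
  mfderiv_const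

theorem der_prodMk {f : M → W} {g : M → W'} {q : M} (hf : MDifferentiableAt I 𝓘(ℝ, W) f q)
    (hg : MDifferentiableAt I 𝓘(ℝ, W') g q) (v : TangentSpace I q) :
    der I (fun z => (f z, g z)) q v = (der I f q v, der I g q v) :=
  have h := hf.prodMk_space hg
  Prod.ext (DFunLike.congr_fun (der_comp h hasFDerivAt_fst) v).symm
    (DFunLike.congr_fun (der_comp h hasFDerivAt_snd) v).symm

theorem der_clm_apply {A : M → W →L[ℝ] W'} {w : M → W} {q : M}
    (hA : MDifferentiableAt I 𝓘(ℝ, W →L[ℝ] W') A q) (hw : MDifferentiableAt I 𝓘(ℝ, W) w q)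
    (v : TangentSpace I q) :
    der I (fun z => A z (w z)) q v = der I A q v (w q) + A q (der I w q v) := by
  have h := der_comp (I := I) (f := fun z => (A z, w z)) (hA.prodMk_space hw)
    (isBoundedBilinearMap_apply.hasFDerivAt (A q, w q))
  rw [h]
  simp [der_prodMk hA hw, add_comm]

theorem eventuallyEq_comp_chart {W : Type*} {c q : M} (hq : q ∈ (chartAt H c).source) (f : M → W) :
    f =ᶠ[nhds q] (f ∘ (extChartAt I c).symm) ∘ extChartAt I c := by
  have hq' : q ∈ (extChartAt I c).source := by rwa [extChartAt_source]
  filter_upwards [extChartAt_source_mem_nhds' hq'] with z hz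
  simp only [Function.comp_apply, (extChartAt I c).left_inv hz]

variable [IsManifold I ∞ M]

theorem mdifferentiableAt_chart {c q : M} (hq : q ∈ (chartAt H c).source) :
    MDifferentiableAt I 𝓘(ℝ, E) (extChartAt I c) q :=
  have : IsManifold I 1 M := IsManifold.of_le (n := ∞) (by simp)
  mdifferentiableAt_extChartAt hq

theorem isInvertible_der_chart {c q : M} (hq : q ∈ (chartAt H c).source) :
    (der I (extChartAt I c) q).IsInvertible :=
  have : IsManifold I 1 M := IsManifold.of_le (n := ∞) (by simp)
  isInvertible_mfderiv_extChartAt (by rwa [extChartAt_source])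

/-- A vector field is smooth when its components in a chart are. -/
theorem contMDiffAt_iff_coord {c q : M} (hq : q ∈ (chartAt H c).source)
    (X : ∀ q : M, TangentSpace I q) :
    ContMDiffAt I I.tangent ∞ (fun q => (⟨q, X q⟩ : TangentBundle I M)) q ↔
      ContMDiffAt I 𝓘(ℝ, E) ∞ (coord c X) q := by
  have : IsManifold I 1 M := IsManifold.of_le (n := ∞) (by simp)
  refine ((trivializationAt E (TangentSpace I) c).contMDiffAt_section_iff hq).trans ?_
  refine Filter.EventuallyEq.contMDiffAt_iff ?_
  filter_upwards [(chartAt H c).open_source.mem_nhds hq] with z hz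
  have h := DFunLike.congr_fun (TangentBundle.continuousLinearMapAt_trivializationAt (I := I) hz) (X z)
  refine Eq.trans ?_ h
  rw [Bundle.Trivialization.continuousLinearMapAt_apply,
    Bundle.Trivialization.coe_linearMapAt_of_mem]
  exact hz

variable [I.Boundaryless]

theorem contMDiffAt_chart_symm {c q : M} (hq : q ∈ (chartAt H c).source) :
    ContMDiffAt 𝓘(ℝ, E) I ∞ (extChartAt I c).symm (extChartAt I c q) := by
  have hq' : q ∈ (extChartAt I c).source := by rwa [extChartAt_source]
  exact (contMDiffOn_extChartAt_symm c).contMDiffAt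
    ((isOpen_extChartAt_target c).mem_nhds ((extChartAt I c).map_source hq'))

theorem contDiffAt_comp_chart_symm {c q : M} (hq : q ∈ (chartAt H c).source) {f : M → W}
    (hf : ContMDiffAt I 𝓘(ℝ, W) ∞ f q) :
    ContDiffAt ℝ ∞ (f ∘ (extChartAt I c).symm) (extChartAt I c q) := by
  have hq' : q ∈ (extChartAt I c).source := by rwa [extChartAt_source]
  rw [← contMDiffAt_iff_contDiffAt]
  refine ContMDiffAt.comp _ ?_ (contMDiffAt_chart_symm hq)
  rwa [(extChartAt I c).left_inv hq']

theorem differentiableAt_comp_chart_symm {c q : M} (hq : q ∈ (chartAt H c).source) {f : M → W}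
    (hf : MDifferentiableAt I 𝓘(ℝ, W) f q) :
    DifferentiableAt ℝ (f ∘ (extChartAt I c).symm) (extChartAt I c q) := by
  have hq' : q ∈ (extChartAt I c).source := by rwa [extChartAt_source]
  rw [← mdifferentiableAt_iff_differentiableAt]
  refine MDifferentiableAt.comp _ ?_ ((contMDiffAt_chart_symm hq).mdifferentiableAt (by simp))
  rwa [(extChartAt I c).left_inv hq']

/-- A function on the manifold is differentiated through its expression in a chart. -/
theorem der_eq_fderiv_chart {c q : M} (hq : q ∈ (chartAt H c).source) {f : M → W}
    (hf : MDifferentiableAt I 𝓘(ℝ, W) f q) (v : TangentSpace I q) :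
    der I f q v = fderiv ℝ (f ∘ (extChartAt I c).symm) (extChartAt I c q)
      (der I (extChartAt I c) q v) := by
  rw [der_congr (eventuallyEq_comp_chart (I := I) hq f)]
  exact DFunLike.congr_fun (der_comp (mdifferentiableAt_chart hq)
    (differentiableAt_comp_chart_symm hq hf).hasFDerivAt) v

/-- Differentiating `f` twice, first along the field `X`, then along the tangent vector `v`. -/
theorem der_der {c q : M} (hq : q ∈ (chartAt H c).source)
    {X : ∀ q : M, TangentSpace I q} (hX : MDifferentiableAt I 𝓘(ℝ, E) (coord c X) q)
    {f : M → W} (hf : ContMDiffAt I 𝓘(ℝ, W) ∞ f q) (v : TangentSpace I q) :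
    der I (fun z => der I f z (X z)) q v =
      fderiv ℝ (fderiv ℝ (f ∘ (extChartAt I c).symm)) (extChartAt I c q)
        (der I (extChartAt I c) q v) (coord c X q)
      + fderiv ℝ (f ∘ (extChartAt I c).symm) (extChartAt I c q) (der I (coord c X) q v) := by
  have h1 : (fun z => der I f z (X z)) =ᶠ[nhds q] fun z =>
      fderiv ℝ (f ∘ (extChartAt I c).symm) (extChartAt I c z) (coord c X z) := by
    have h2 : ∀ᶠ z in nhds q, ContMDiffAt I 𝓘(ℝ, W) 1 f z :=
      (contMDiffAt_iff_contMDiffAt_nhds (by simp)).1 (hf.of_le (by simp))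
    filter_upwards [h2, (chartAt H c).open_source.mem_nhds hq] with z hz hz'
    exact der_eq_fderiv_chart hz' (hz.mdifferentiableAt (by simp)) _
  have h3 : DifferentiableAt ℝ (fderiv ℝ (f ∘ (extChartAt I c).symm)) (extChartAt I c q) :=
    (((contDiffAt_comp_chart_symm hq hf).of_le (m := 2) two_le_infty).fderiv_right
      (m := 1) (by norm_num)).differentiableAt (by simp)
  have h4 : MDifferentiableAt I 𝓘(ℝ, E →L[ℝ] W)
      (fun z => fderiv ℝ (f ∘ (extChartAt I c).symm) (extChartAt I c z)) q :=
    h3.mdifferentiableAt.comp q (mdifferentiableAt_chart hq)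
  rw [der_congr h1, der_clm_apply h4 hX, der_comp (mdifferentiableAt_chart hq) h3.hasFDerivAt]
  rfl

variable [CompleteSpace E]

/-- The components of a Lie bracket in a chart. -/
theorem coord_mlieBracket {c q : M} (hq : q ∈ (chartAt H c).source)
    {X Y : ∀ q : M, TangentSpace I q}
    (hX : MDifferentiableAt I 𝓘(ℝ, E) (coord c X) q)
    (hY : MDifferentiableAt I 𝓘(ℝ, E) (coord c Y) q) :
    coord c (mlieBracket I X Y) q =
      der I (coord c Y) q (X q) - der I (coord c X) q (Y q) := by
  have : IsManifold I (minSmoothness ℝ 2) M :=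
    IsManifold.of_le (n := ∞) (by rw [minSmoothness_of_isRCLikeNormedField]; exact two_le_infty)
  have hq' : q ∈ (extChartAt I c).source := by rwa [extChartAt_source]
  -- The bracket is natural under the chart, of which `X` and `Y` are pullbacks near `q`.
  let T : (∀ q : M, TangentSpace I q) → E → E :=
    fun Z => coord c Z ∘ (extChartAt I c).symm
  have hTc : ∀ Z : ∀ q : M, TangentSpace I q, ∀ z ∈ (extChartAt I c).source,
      T Z (extChartAt I c z) = der I (extChartAt I c) z (Z z) := by
    intro Z z hz
    simp only [T, Function.comp_apply, (extChartAt I c).left_inv hz]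
    rfl
  have hpull : ∀ Z : ∀ q : M, TangentSpace I q,
      Z =ᶠ[nhds q] mpullback I 𝓘(ℝ, E) (extChartAt I c) (T Z) := by
    intro Z
    filter_upwards [extChartAt_source_mem_nhds' hq'] with z hz
    have hz' : z ∈ (chartAt H c).source := by rwa [extChartAt_source] at hz
    exact ((isInvertible_der_chart hz').inverse_apply_eq.2 (hTc Z z hz)).symm
  have hT' : ∀ Z : ∀ q : M, TangentSpace I q, MDifferentiableAt I 𝓘(ℝ, E) (coord c Z) q →
      MDifferentiableAt 𝓘(ℝ, E) 𝓘(ℝ, E).tangent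
        (fun z => (⟨z, T Z z⟩ : TangentBundle 𝓘(ℝ, E) E)) (extChartAt I c q) := by
    intro Z hZ
    refine (mdifferentiableAt_section (F := E) (E := TangentSpace 𝓘(ℝ, E)) 𝓘(ℝ, E) (T Z)).2 ?_
    have := (differentiableAt_comp_chart_symm hq hZ).mdifferentiableAt
    refine this.congr_of_eventuallyEq (Filter.Eventually.of_forall fun z => ?_)
    simp [T]
  have h1 : mlieBracket I X Y q = (mfderiv I 𝓘(ℝ, E) (extChartAt I c) q).inverse
      (mlieBracket 𝓘(ℝ, E) (T X) (T Y) (extChartAt I c q)) := by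
    rw [(hpull X).mlieBracket_vectorField_eq (hpull Y),
      ← mpullback_mlieBracket (n := ∞) (hT' X hX) (hT' Y hY)
      (contMDiffAt_extChartAt' hq)
      (by rw [minSmoothness_of_isRCLikeNormedField]; exact two_le_infty), mpullback_apply]
  have h2 : mlieBracket 𝓘(ℝ, E) (T X) (T Y) (extChartAt I c q) =
      lieBracket ℝ (T X) (T Y) (extChartAt I c q) := by
    refine (congrFun (mlieBracketWithin_univ (I := 𝓘(ℝ, E)) (V := T X) (W := T Y)).symm _).trans
      ((congrFun (mlieBracketWithin_eq_lieBracketWithin (V := T X) (W := T Y)) _).trans ?_)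
    rw [lieBracketWithin_univ]
  rw [der_eq_fderiv_chart hq hX, der_eq_fderiv_chart hq hY, ← hTc X q hq', ← hTc Y q hq']
  have h3 := (isInvertible_der_chart (I := I) hq).self_apply_inverse
    (lieBracket ℝ (T X) (T Y) (extChartAt I c q))
  rw [coord, h1, h2]
  exact h3

/-- A Lie bracket acts on functions as the commutator of derivations. -/
theorem der_mlieBracket {q : M} {X Y : ∀ q : M, TangentSpace I q}
    (hX : ContMDiffAt I I.tangent ∞ (fun q => (⟨q, X q⟩ : TangentBundle I M)) q)
    (hY : ContMDiffAt I I.tangent ∞ (fun q => (⟨q, Y q⟩ : TangentBundle I M)) q)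
    {f : M → W} (hf : ContMDiffAt I 𝓘(ℝ, W) ∞ f q) :
    der I f q (mlieBracket I X Y q) =
      der I (fun z => der I f z (Y z)) q (X q) - der I (fun z => der I f z (X z)) q (Y q) := by
  have hq := mem_chart_source H q
  have hX' := ((contMDiffAt_iff_coord hq X).1 hX).mdifferentiableAt (by simp)
  have hY' := ((contMDiffAt_iff_coord hq Y).1 hY).mdifferentiableAt (by simp)
  have hs : IsSymmSndFDerivAt ℝ (f ∘ (extChartAt I q).symm) (extChartAt I q q) :=
    (contDiffAt_comp_chart_symm hq hf).isSymmSndFDerivAt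
      (by rw [minSmoothness_of_isRCLikeNormedField]; exact two_le_infty)
  have h := coord_mlieBracket hq hX' hY'
  rw [der_der hq hX' hf, der_der hq hY' hf, der_eq_fderiv_chart hq (hf.mdifferentiableAt (by simp))]
  rw [coord] at h
  rw [h, map_sub]
  have h' := hs.eq (coord q X q) (coord q Y q)
  simp only [coord] at h' ⊢
  rw [h']
  abel

end Coordinates

/-! ### The geometry of the tangent bundle -/

section TangentBundle

variable {n : ℕ} {M : Type*} [TopologicalSpace M] [ChartedSpace (V n) M] [IsManifold (𝓡 n) ∞ M]

theorem mem_chart_iff {c q : TB n M} : q ∈ (chartAt (ModelProd (V n) (V n)) c).source ↔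
    q.1 ∈ (chartAt (V n) c.1).source :=
  TangentBundle.mem_chart_source_iff q c

/-- In a chart of `TM`, the fibre coordinates are the components of the tangent vector. -/
theorem chart_apply {c q : TB n M} (hq : q.1 ∈ (chartAt (V n) c.1).source) :
    extChartAt (𝓡 n).tangent c q =
      (extChartAt (𝓡 n) c.1 q.1, der (𝓡 n) (extChartAt (𝓡 n) c.1) q.1 q.2) := by
  have h := DFunLike.congr_fun
    (TangentBundle.continuousLinearMapAt_trivializationAt (I := 𝓡 n) hq) q.2
  refine Prod.ext rfl (Eq.trans ?_ h)
  rw [Bundle.Trivialization.continuousLinearMapAt_apply,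
    Bundle.Trivialization.coe_linearMapAt_of_mem]
  · rfl
  · exact hq

theorem mdifferentiableAt_proj (q : TB n M) :
    MDifferentiableAt (𝓡 n).tangent (𝓡 n) (fun q : TB n M => q.1) q :=
  Bundle.mdifferentiableAt_proj (TangentSpace (𝓡 n))

/-- In coordinates, `ρ` is the first projection. -/
theorem der_chart_fst {c q : TB n M} (hq : q.1 ∈ (chartAt (V n) c.1).source)
    (v : TangentSpace (𝓡 n).tangent q) :
    (der (𝓡 n).tangent (extChartAt (𝓡 n).tangent c) q v).1 =
      der (𝓡 n) (extChartAt (𝓡 n) c.1) q.1 (rho q v) := by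
  have h1 := DFunLike.congr_fun (der_comp (mdifferentiableAt_chart (I := (𝓡 n).tangent)
    (mem_chart_iff.2 hq)) (hasFDerivAt_fst (𝕜 := ℝ) (E := V n) (F := V n))) v
  refine h1.symm.trans ?_
  exact DFunLike.congr_fun (mfderiv_comp q (mdifferentiableAt_chart (I := 𝓡 n) hq)
    (mdifferentiableAt_proj q)) v

theorem contMDiff_incl (x : M) : ContMDiff 𝓘(ℝ, V n) (𝓡 n).tangent ∞ (incl (n := n) x) := by
  intro w
  rw [Bundle.contMDiffAt_totalSpace]
  refine ⟨contMDiffAt_const, ?_⟩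
  let L : V n →L[ℝ] V n := der (𝓡 n) (extChartAt (𝓡 n) x) x
  have : ContMDiff 𝓘(ℝ, V n) 𝓘(ℝ, V n) ∞ L := L.contDiff.contMDiff
  refine (this w).congr_of_eventuallyEq (Filter.Eventually.of_forall fun w => ?_)
  exact congrArg Prod.snd (chart_apply (c := incl x w) (q := incl x w) (mem_chart_source _ x))

/-- In coordinates, `γ` is the inclusion of the second factor. -/
theorem der_chart_gam {c q : TB n M} (hq : q.1 ∈ (chartAt (V n) c.1).source)
    (v : TangentSpace (𝓡 n) q.1) :
    der (𝓡 n).tangent (extChartAt (𝓡 n).tangent c) q (gam q v) =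
      (0, der (𝓡 n) (extChartAt (𝓡 n) c.1) q.1 v) := by
  let L : V n →L[ℝ] V n := der (𝓡 n) (extChartAt (𝓡 n) c.1) q.1
  have h2 := mfderiv_comp (I := 𝓘(ℝ, V n)) (I' := (𝓡 n).tangent) (I'' := 𝓘(ℝ, V n × V n))
    (f := incl q.1) (g := extChartAt (𝓡 n).tangent c) (toModel q.2)
    (mdifferentiableAt_chart (I := (𝓡 n).tangent) (mem_chart_iff.2 hq))
    ((contMDiff_incl q.1 _).mdifferentiableAt (by simp))
  have h3 : (extChartAt (𝓡 n).tangent c) ∘ incl q.1 =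
      fun w : V n => (extChartAt (𝓡 n) c.1 q.1, L w) := by
    funext w
    exact chart_apply (c := c) (q := incl q.1 w) hq
  have h4 : HasFDerivAt (fun w : V n => (extChartAt (𝓡 n) c.1 q.1, L w))
      ((0 : V n →L[ℝ] V n).prod L) (toModel q.2) :=
    (hasFDerivAt_const _ _).prodMk L.hasFDerivAt
  rw [h3, mfderiv_eq_fderiv, h4.fderiv] at h2
  exact (DFunLike.congr_fun h2 (toModel v)).symm


theorem gam_add (p : TB n M) (u v : TangentSpace (𝓡 n) p.1) : gam p (u + v) = gam p u + gam p v :=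
  map_add (mfderiv 𝓘(ℝ, V n) (𝓡 n).tangent (incl p.1) (toModel p.2)) _ _

theorem gam_smul (p : TB n M) (t : ℝ) (u : TangentSpace (𝓡 n) p.1) :
    gam p (t • u) = t • gam p u :=
  map_smul (mfderiv 𝓘(ℝ, V n) (𝓡 n).tangent (incl p.1) (toModel p.2)) _ _

theorem gam_zero (p : TB n M) : gam p 0 = 0 :=
  map_zero (mfderiv 𝓘(ℝ, V n) (𝓡 n).tangent (incl p.1) (toModel p.2))

theorem gam_injective (p : TB n M) : Function.Injective (gam p) := by
  intro u v h
  have hp := mem_chart_source (V n) p.1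
  have h' := congrArg (der (𝓡 n).tangent (extChartAt (𝓡 n).tangent p) p) h
  rw [der_chart_gam hp, der_chart_gam hp] at h'
  exact (isInvertible_der_chart hp).injective (congrArg Prod.snd h')

theorem rho_gam (p : TB n M) (u : TangentSpace (𝓡 n) p.1) : rho p (gam p u) = 0 := by
  have hp := mem_chart_source (V n) p.1
  apply (isInvertible_der_chart (I := 𝓡 n) hp).injective
  rw [← der_chart_fst hp, der_chart_gam hp, map_zero]

/-- The vertical vectors are the vertical lifts. -/
theorem exists_gam_eq {p : TB n M} {v : TangentSpace (𝓡 n).tangent p} (h : rho p v = 0) :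
    ∃ u, gam p u = v := by
  have hp := mem_chart_source (V n) p.1
  obtain ⟨u, hu⟩ := (isInvertible_der_chart (I := 𝓡 n) hp).surjective
    (der (𝓡 n).tangent (extChartAt (𝓡 n).tangent p) p v).2
  refine ⟨u, (isInvertible_der_chart (I := (𝓡 n).tangent) (mem_chart_iff.2 hp)).injective ?_⟩
  rw [der_chart_gam hp, hu]
  refine Prod.ext ?_ rfl
  rw [der_chart_fst hp, h, map_zero]

theorem J_eq_zero_iff {X : Field n M} {p : TB n M} : J X p = 0 ↔ rho p (X p) = 0 :=
  ⟨fun h => gam_injective p (h.trans (gam_zero p).symm), fun h => by rw [J, h, gam_zero]⟩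

/-- Smoothness of a vector field on `TM` at a point. -/
def Field.SmoothAt (X : Field n M) (p : TB n M) : Prop :=
  ContMDiffAt (𝓡 n).tangent (𝓡 n).tangent.tangent ∞
    (fun q : TB n M => (⟨q, X q⟩ : TangentBundle (𝓡 n).tangent (TB n M))) p

theorem Field.SmoothOn.smoothAt {X : Field n M} {U : Set (TB n M)} (hX : X.SmoothOn U)
    (hU : IsOpen U) {p : TB n M} (hp : p ∈ U) : X.SmoothAt p :=
  hX.contMDiffAt (hU.mem_nhds hp)

theorem Field.smoothOn_of_smoothAt {X : Field n M} {U : Set (TB n M)}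
    (h : ∀ p ∈ U, X.SmoothAt p) : X.SmoothOn U :=
  fun p hp => (h p hp).contMDiffWithinAt

theorem Field.SmoothOn.mono {X : Field n M} {U U' : Set (TB n M)} (hX : X.SmoothOn U)
    (h : U' ⊆ U) : X.SmoothOn U' :=
  ContMDiffOn.mono hX h

theorem Field.SmoothAt.congr {X Y : Field n M} {p : TB n M} (hX : X.SmoothAt p)
    (h : X =ᶠ[nhds p] Y) : Y.SmoothAt p :=
  ContMDiffAt.congr_of_eventuallyEq hX (h.mono fun q hq => by simp only [hq])

theorem Field.smoothAt_iff {c p : TB n M} (hp : p.1 ∈ (chartAt (V n) c.1).source)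
    (X : Field n M) :
    X.SmoothAt p ↔ ContMDiffAt (𝓡 n).tangent 𝓘(ℝ, V n × V n) ∞ (coord c X) p :=
  contMDiffAt_iff_coord (mem_chart_iff.2 hp) X

theorem Field.SmoothAt.coord {c p : TB n M} (hp : p.1 ∈ (chartAt (V n) c.1).source)
    {X : Field n M} (hX : X.SmoothAt p) :
    MDifferentiableAt (𝓡 n).tangent 𝓘(ℝ, V n × V n) (coord c X) p :=
  ((Field.smoothAt_iff hp X).1 hX).mdifferentiableAt (by simp)

theorem eq_of_coord_eq {c p : TB n M} (hp : p.1 ∈ (chartAt (V n) c.1).source) {X Y : Field n M}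
    (h : coord c X p = coord c Y p) : X p = Y p :=
  (isInvertible_der_chart (I := (𝓡 n).tangent) (mem_chart_iff.2 hp)).injective h

/-- The tangent structure in coordinates, `(a, b) ↦ (0, a)`. -/
noncomputable def shift (n : ℕ) : V n × V n →L[ℝ] V n × V n :=
  (ContinuousLinearMap.inr ℝ (V n) (V n)).comp (ContinuousLinearMap.fst ℝ (V n) (V n))

/-- The projection `(a, b) ↦ (0, b)`, which is the Liouville field in coordinates. -/
noncomputable def vert (n : ℕ) : V n × V n →L[ℝ] V n × V n :=
  (ContinuousLinearMap.inr ℝ (V n) (V n)).comp (ContinuousLinearMap.snd ℝ (V n) (V n))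

theorem shift_shift (w : V n × V n) : shift n (shift n w) = 0 := rfl

theorem shift_vert (w : V n × V n) : shift n (vert n w) = 0 := rfl

theorem vert_shift (w : V n × V n) : vert n (shift n w) = shift n w := rfl

theorem der_chart_J {c q : TB n M} (hq : q.1 ∈ (chartAt (V n) c.1).source)
    (v : TangentSpace (𝓡 n).tangent q) :
    der (𝓡 n).tangent (extChartAt (𝓡 n).tangent c) q (gam q (rho q v)) =
      shift n (der (𝓡 n).tangent (extChartAt (𝓡 n).tangent c) q v) := by
  rw [der_chart_gam hq, ← der_chart_fst hq]
  rfl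

theorem coord_J {c q : TB n M} (hq : q.1 ∈ (chartAt (V n) c.1).source) (X : Field n M) :
    coord c (J X) q = shift n (coord c X q) :=
  der_chart_J hq (X q)

theorem coord_liouville {c q : TB n M} (hq : q.1 ∈ (chartAt (V n) c.1).source) :
    coord c liouville q = vert n (extChartAt (𝓡 n).tangent c q) := by
  rw [chart_apply hq]
  exact der_chart_gam hq q.2

theorem eventually_mem_chart {c q : TB n M} (hq : q.1 ∈ (chartAt (V n) c.1).source) :
    ∀ᶠ z in nhds q, z.1 ∈ (chartAt (V n) c.1).source := by
  filter_upwards [(chartAt (ModelProd (V n) (V n)) c).open_source.mem_nhds (mem_chart_iff.2 hq)]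
    with z hz using mem_chart_iff.1 hz

theorem der_coord_J {c q : TB n M} (hq : q.1 ∈ (chartAt (V n) c.1).source) {X : Field n M}
    (hX : X.SmoothAt q) (v : TangentSpace (𝓡 n).tangent q) :
    der (𝓡 n).tangent (coord c (J X)) q v = shift n (der (𝓡 n).tangent (coord c X) q v) := by
  rw [der_congr ((eventually_mem_chart hq).mono fun z hz => coord_J hz X),
    der_comp (hX.coord hq) (shift n).hasFDerivAt]
  rfl

theorem der_coord_liouville {c q : TB n M} (hq : q.1 ∈ (chartAt (V n) c.1).source)
    (v : TangentSpace (𝓡 n).tangent q) :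
    der (𝓡 n).tangent (coord c liouville) q v =
      vert n (der (𝓡 n).tangent (extChartAt (𝓡 n).tangent c) q v) := by
  rw [der_congr ((eventually_mem_chart hq).mono fun z hz => coord_liouville hz),
    der_comp (mdifferentiableAt_chart (mem_chart_iff.2 hq)) (vert n).hasFDerivAt]
  rfl

theorem Field.SmoothAt.J {X : Field n M} {p : TB n M} (hX : X.SmoothAt p) :
    (Finsler.J X).SmoothAt p := by
  have hp := mem_chart_source (V n) p.1
  rw [Field.smoothAt_iff hp] at hX ⊢
  exact ((shift n).contDiff.contMDiff.contMDiffAt.comp p hX).congr_of_eventuallyEq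
    ((eventually_mem_chart hp).mono fun z hz => coord_J hz X)

theorem smoothAt_liouville (p : TB n M) : (liouville (n := n) (M := M)).SmoothAt p := by
  have hp := mem_chart_source (V n) p.1
  rw [Field.smoothAt_iff hp]
  exact ((vert n).contDiff.contMDiff.contMDiffAt.comp p contMDiffAt_extChartAt).congr_of_eventuallyEq
    ((eventually_mem_chart hp).mono fun z hz => coord_liouville hz)

theorem Field.SmoothAt.bracket {X Y : Field n M} {p : TB n M} (hX : X.SmoothAt p)
    (hY : Y.SmoothAt p) : (Finsler.bracket X Y).SmoothAt p := by
  have h : IsManifold (𝓡 n).tangent ∞ (TB n M) := inferInstance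
  have h' : IsManifold (𝓡 n).tangent (minSmoothness ℝ 2) (TB n M) :=
    IsManifold.of_le (n := ∞) (by rw [minSmoothness_of_isRCLikeNormedField]; exact two_le_infty)
  have : IsManifold (𝓡 n).tangent ((⊤ : ℕ∞) + 1 : ℕ∞ω) (TB n M) := h
  exact ContMDiffAt.mlieBracket_vectorField (m := ⊤) (n := ⊤) hX hY
    (by rw [minSmoothness_of_isRCLikeNormedField]; rfl)

theorem Field.SmoothAt.add {X Y : Field n M} {p : TB n M} (hX : X.SmoothAt p)
    (hY : Y.SmoothAt p) : Field.SmoothAt (fun q => X q + Y q) p :=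
  ContMDiffAt.add_section hX hY

theorem Field.SmoothAt.sub {X Y : Field n M} {p : TB n M} (hX : X.SmoothAt p)
    (hY : Y.SmoothAt p) : Field.SmoothAt (fun q => X q - Y q) p :=
  ContMDiffAt.sub_section hX hY

theorem Field.SmoothAt.smul {f : TB n M → ℝ} {X : Field n M} {p : TB n M}
    (hf : ContMDiffAt (𝓡 n).tangent 𝓘(ℝ, ℝ) ∞ f p)
    (hX : X.SmoothAt p) : Field.SmoothAt (fun q => f q • X q) p :=
  ContMDiffAt.smul_section hf hX

theorem coord_bracket {c q : TB n M} (hq : q.1 ∈ (chartAt (V n) c.1).source) {X Y : Field n M}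
    (hX : X.SmoothAt q) (hY : Y.SmoothAt q) :
    coord c (bracket X Y) q = der (𝓡 n).tangent (coord c Y) q (X q) -
      der (𝓡 n).tangent (coord c X) q (Y q) :=
  coord_mlieBracket (mem_chart_iff.2 hq) (hX.coord hq) (hY.coord hq)

theorem bracket_congr {X X' Y Y' : Field n M} {p : TB n M} (hX : X =ᶠ[nhds p] X')
    (hY : Y =ᶠ[nhds p] Y') : bracket X Y p = bracket X' Y' p :=
  hX.mlieBracket_vectorField_eq hY

/-- The Nijenhuis tensor of the tangent structure vanishes. -/
theorem bracket_J_J {X Y : Field n M} {p : TB n M} (hX : X.SmoothAt p) (hY : Y.SmoothAt p) :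
    bracket (J X) (J Y) p = J (bracket (J X) Y) p + J (bracket X (J Y)) p := by
  have hp := mem_chart_source (V n) p.1
  refine eq_of_coord_eq (Y := fun q => J (bracket (J X) Y) q + J (bracket X (J Y)) q) hp ?_
  rw [coord_bracket hp hX.J hY.J, der_coord_J hp hX, der_coord_J hp hY]
  have h1 : coord p (fun q => J (bracket (J X) Y) q + J (bracket X (J Y)) q) p =
      coord p (J (bracket (J X) Y)) p + coord p (J (bracket X (J Y))) p := map_add _ _ _
  rw [h1, coord_J hp, coord_J hp, coord_bracket hp hX.J hY, coord_bracket hp hX hY.J,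
    der_coord_J hp hX, der_coord_J hp hY]
  simp only [map_sub, shift_shift]
  abel

/-- The Lie derivative of the tangent structure along the Liouville field is its opposite. -/
theorem bracket_liouville_J {X : Field n M} {p : TB n M} (hX : X.SmoothAt p) :
    bracket liouville (J X) p = J (bracket liouville X) p - J X p := by
  have hp := mem_chart_source (V n) p.1
  refine eq_of_coord_eq (Y := fun q => J (bracket liouville X) q - J X q) hp ?_
  have h1 : coord p (fun q => J (bracket liouville X) q - J X q) p =
      coord p (J (bracket liouville X)) p - coord p (J X) p := map_sub _ _ _
  rw [h1, coord_bracket hp (smoothAt_liouville p) hX.J, coord_J hp, coord_J hp,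
    coord_bracket hp (smoothAt_liouville p) hX, der_coord_J hp hX, der_coord_liouville hp,
    der_coord_liouville hp]
  have h2 := der_chart_J (c := p) hp (X p)
  rw [J, h2]
  simp only [map_sub, shift_vert, vert_shift, sub_zero]
  rfl

end TangentBundle

/-! ### Functions on the tangent bundle and their fibre Hessians -/

section Functions

variable {n : ℕ} {M : Type*} [TopologicalSpace M] [ChartedSpace (V n) M] [IsManifold (𝓡 n) ∞ M]

/-- The derivative of the function `f` along the vector field `X`. -/
noncomputable def lie (X : Field n M) (f : TB n M → ℝ) : TB n M → ℝ := fun q => dfun f q (X q)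

/-- Smoothness of a function on `TM` at a point. -/
abbrev FunSmoothAt (f : TB n M → ℝ) (p : TB n M) : Prop :=
  ContMDiffAt (𝓡 n).tangent 𝓘(ℝ, ℝ) ∞ f p

theorem FunSmoothAt.mdifferentiableAt {f : TB n M → ℝ} {p : TB n M} (hf : FunSmoothAt f p) :
    MDifferentiableAt (𝓡 n).tangent 𝓘(ℝ, ℝ) f p :=
  ContMDiffAt.mdifferentiableAt hf (by simp)

theorem dfun_map_add (f : TB n M → ℝ) (p : TB n M) (v w : TangentSpace (𝓡 n).tangent p) :
    dfun f p (v + w) = dfun f p v + dfun f p w :=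
  map_add (der (𝓡 n).tangent f p) v w

theorem dfun_map_sub (f : TB n M → ℝ) (p : TB n M) (v w : TangentSpace (𝓡 n).tangent p) :
    dfun f p (v - w) = dfun f p v - dfun f p w :=
  map_sub (der (𝓡 n).tangent f p) v w

theorem dfun_map_neg (f : TB n M → ℝ) (p : TB n M) (v : TangentSpace (𝓡 n).tangent p) :
    dfun f p (-v) = -dfun f p v :=
  map_neg (der (𝓡 n).tangent f p) v

theorem dfun_map_smul (f : TB n M → ℝ) (p : TB n M) (t : ℝ) (v : TangentSpace (𝓡 n).tangent p) :
    dfun f p (t • v) = t * dfun f p v :=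
  map_smul (der (𝓡 n).tangent f p) t v

theorem dfun_map_zero (f : TB n M → ℝ) (p : TB n M) : dfun f p 0 = 0 :=
  map_zero (der (𝓡 n).tangent f p)

theorem dfun_congr {f g : TB n M → ℝ} {p : TB n M} (h : f =ᶠ[nhds p] g)
    (v : TangentSpace (𝓡 n).tangent p) : dfun f p v = dfun g p v :=
  DFunLike.congr_fun (der_congr h) v

theorem dfun_const (t : ℝ) (p : TB n M) (v : TangentSpace (𝓡 n).tangent p) :
    dfun (fun _ => t) p v = 0 :=
  DFunLike.congr_fun (der_const t p) v

theorem dfun_comp {f : TB n M → ℝ} {p : TB n M} (hf : FunSmoothAt f p) {h : ℝ → ℝ} {h' : ℝ}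
    (hh : HasDerivAt h h' (f p)) (v : TangentSpace (𝓡 n).tangent p) :
    dfun (fun q => h (f q)) p v = h' * dfun f p v := by
  refine (DFunLike.congr_fun (der_comp hf.mdifferentiableAt hh.hasFDerivAt) v).trans ?_
  exact mul_comm _ _

theorem dfun_comp₂ {f g : TB n M → ℝ} {p : TB n M} (hf : FunSmoothAt f p) (hg : FunSmoothAt g p)
    {h : ℝ × ℝ → ℝ} {h' : ℝ × ℝ →L[ℝ] ℝ} (hh : HasFDerivAt h h' (f p, g p))
    (v : TangentSpace (𝓡 n).tangent p) :
    dfun (fun q => h (f q, g q)) p v = h' (dfun f p v, dfun g p v) := by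
  refine (DFunLike.congr_fun (der_comp (f := fun q => (f q, g q))
    (hf.mdifferentiableAt.prodMk_space hg.mdifferentiableAt) hh) v).trans ?_
  exact congrArg h' (der_prodMk hf.mdifferentiableAt hg.mdifferentiableAt v)

theorem dfun_add {f g : TB n M → ℝ} {p : TB n M} (hf : FunSmoothAt f p) (hg : FunSmoothAt g p)
    (v : TangentSpace (𝓡 n).tangent p) :
    dfun (fun q => f q + g q) p v = dfun f p v + dfun g p v :=
  dfun_comp₂ hf hg (hasFDerivAt_fst.add hasFDerivAt_snd) v

theorem dfun_mul {f g : TB n M → ℝ} {p : TB n M} (hf : FunSmoothAt f p) (hg : FunSmoothAt g p)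
    (v : TangentSpace (𝓡 n).tangent p) :
    dfun (fun q => f q * g q) p v = dfun f p v * g p + f p * dfun g p v := by
  refine (dfun_comp₂ hf hg (hasFDerivAt_fst.mul hasFDerivAt_snd) v).trans ?_
  simp
  ring

theorem dfun_const_mul {f : TB n M → ℝ} {p : TB n M} (hf : FunSmoothAt f p) (t : ℝ)
    (v : TangentSpace (𝓡 n).tangent p) :
    dfun (fun q => t * f q) p v = t * dfun f p v := by
  simpa using dfun_comp hf ((hasDerivAt_id (f p)).const_mul t) v

theorem lie_apply (X : Field n M) (f : TB n M → ℝ) (p : TB n M) : lie X f p = dfun f p (X p) := rfl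

theorem FunSmoothAt.lie {f : TB n M → ℝ} {X : Field n M} {p : TB n M} (hf : FunSmoothAt f p)
    (hX : X.SmoothAt p) : FunSmoothAt (lie X f) p := by
  have hp := mem_chart_source (V n) p.1
  have hp' := mem_chart_source (ModelProd (V n) (V n)) p
  have h1 : Finsler.lie X f =ᶠ[nhds p] fun z =>
      fderiv ℝ (f ∘ (extChartAt (𝓡 n).tangent p).symm) (extChartAt (𝓡 n).tangent p z)
        (coord p X z) := by
    have h2 : ∀ᶠ z in nhds p, ContMDiffAt (𝓡 n).tangent 𝓘(ℝ, ℝ) 1 f z :=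
      (contMDiffAt_iff_contMDiffAt_nhds (by simp)).1 (ContMDiffAt.of_le hf (by simp))
    filter_upwards [h2, eventually_mem_chart hp] with z hz hz'
    exact der_eq_fderiv_chart (mem_chart_iff.2 hz') (hz.mdifferentiableAt (by simp)) _
  have h3 : ContDiffAt ℝ ∞ (fderiv ℝ (f ∘ (extChartAt (𝓡 n).tangent p).symm))
      (extChartAt (𝓡 n).tangent p p) :=
    (contDiffAt_comp_chart_symm hp' hf).fderiv_right (by exact le_rfl)
  have h4 := h3.contMDiffAt.comp p (contMDiffAt_extChartAt (I := (𝓡 n).tangent) (n := ∞) (x := p))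
  exact (h4.clm_apply ((Field.smoothAt_iff hp X).1 hX)).congr_of_eventuallyEq h1

theorem dfun_bracket {f : TB n M → ℝ} {X Y : Field n M} {p : TB n M} (hf : FunSmoothAt f p)
    (hX : X.SmoothAt p) (hY : Y.SmoothAt p) :
    dfun f p (bracket X Y p) = dfun (lie Y f) p (X p) - dfun (lie X f) p (Y p) :=
  der_mlieBracket hX hY hf

/-- The bracket of a field with a function multiple of another one. -/
theorem bracket_smul {f : TB n M → ℝ} {X Y : Field n M} {p : TB n M} (hf : FunSmoothAt f p)
    (hY : Y.SmoothAt p) :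
    bracket X (fun q => f q • Y q) p = dfun f p (X p) • Y p + f p • bracket X Y p := by
  have : IsManifold (𝓡 n).tangent 2 (TB n M) := IsManifold.of_le (n := ∞) two_le_infty
  exact VectorField.mlieBracket_smul_right hf.mdifferentiableAt
    (ContMDiffAt.mdifferentiableAt hY (by simp))

theorem bracket_add {X Y Z : Field n M} {p : TB n M} (hY : Y.SmoothAt p) (hZ : Z.SmoothAt p) :
    bracket X (fun q => Y q + Z q) p = bracket X Y p + bracket X Z p := by
  have : IsManifold (𝓡 n).tangent 2 (TB n M) := IsManifold.of_le (n := ∞) two_le_infty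
  exact VectorField.mlieBracket_add_right
    (ContMDiffAt.mdifferentiableAt hY (by simp)) (ContMDiffAt.mdifferentiableAt hZ (by simp))

theorem bracket_swap (X Y : Field n M) (p : TB n M) : bracket X Y p = -bracket Y X p :=
  VectorField.mlieBracket_swap_apply

theorem bracket_self (X : Field n M) (p : TB n M) : bracket X X p = 0 :=
  congrFun VectorField.mlieBracket_self p

theorem bracket_eq_zero_of_eventually_right {X Y : Field n M} {p : TB n M}
    (h : ∀ᶠ q in nhds p, Y q = 0) : bracket X Y p = 0 := by
  rw [bracket_congr (X' := X) (Y' := 0) (Filter.EventuallyEq.refl _ X) h]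
  exact congrFun VectorField.mlieBracket_zero_right p

/-- The second derivative of `f` along the fibre through `p`; the metric of `F` is, by definition,
the one of the energy. -/
noncomputable def hess (f : TB n M → ℝ) (p : TB n M) (u v : TangentSpace (𝓡 n) p.1) : ℝ :=
  fderiv ℝ (fun w : V n => fderiv ℝ (fun w' : V n => f (incl p.1 w')) w (toModel v))
    (toModel p.2) (toModel u)

/-- The fibre Hessian as a second derivative in the chart at `p`, which shows that it is symmetric. -/
theorem hess_eq {f : TB n M → ℝ} {p : TB n M} (hf : FunSmoothAt f p)
    (u v : TangentSpace (𝓡 n) p.1) :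
    hess f p u v = fderiv ℝ (fderiv ℝ (f ∘ (extChartAt (𝓡 n).tangent p).symm))
      (extChartAt (𝓡 n).tangent p p)
      (der (𝓡 n).tangent (extChartAt (𝓡 n).tangent p) p (gam p u))
      (der (𝓡 n).tangent (extChartAt (𝓡 n).tangent p) p (gam p v)) := by
  have hp := mem_chart_source (V n) p.1
  have hp' := mem_chart_source (ModelProd (V n) (V n)) p
  -- In the chart, the inclusion of the fibre is the affine map `B`.
  let L : V n →L[ℝ] V n := der (𝓡 n) (extChartAt (𝓡 n) p.1) p.1
  let L' : V n →L[ℝ] V n × V n := (0 : V n →L[ℝ] V n).prod L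
  let B : V n → V n × V n := fun w => (extChartAt (𝓡 n) p.1 p.1, L w)
  let g : V n × V n → ℝ := f ∘ (extChartAt (𝓡 n).tangent p).symm
  have hB : ∀ w, HasFDerivAt B L' w := fun w => (hasFDerivAt_const _ _).prodMk L.hasFDerivAt
  have hB' : ∀ w : V n, extChartAt (𝓡 n).tangent p (incl p.1 w) = B w := fun w =>
    chart_apply (c := p) (q := incl p.1 w) hp
  have hBp : B (toModel p.2) = extChartAt (𝓡 n).tangent p p := (hB' p.2).symm
  have hg : ContDiffAt ℝ ∞ g (B (toModel p.2)) := by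
    rw [hBp]; exact contDiffAt_comp_chart_symm hp' hf
  have hfg : (fun w : V n => f (incl p.1 w)) = fun w => g (B w) := by
    funext w
    have : incl p.1 w ∈ (extChartAt (𝓡 n).tangent p).source := by
      rw [extChartAt_source]; exact mem_chart_iff.2 hp
    simp only [g, Function.comp_apply, ← hB', (extChartAt (𝓡 n).tangent p).left_inv this]
  have hg1 : ∀ᶠ w in nhds (toModel p.2), DifferentiableAt ℝ g (B w) := by
    have h1 : ∀ᶠ z in nhds (B (toModel p.2)), DifferentiableAt ℝ g z :=
      ((hg.of_le (m := 1) (by simp)).eventually (by simp)).mono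
        fun z hz => hz.differentiableAt (by simp)
    exact (hB _).continuousAt.eventually h1
  have hg2 : DifferentiableAt ℝ (fderiv ℝ g) (B (toModel p.2)) :=
    ((hg.of_le (m := 2) two_le_infty).fderiv_right (m := 1) (by norm_num)).differentiableAt
      (by simp)
  have h2 : (fun w : V n => fderiv ℝ (fun w' : V n => f (incl p.1 w')) w (toModel v))
      =ᶠ[nhds (toModel p.2)] fun w => fderiv ℝ g (B w) (L' (toModel v)) := by
    filter_upwards [hg1] with w hw
    rw [hfg]
    exact DFunLike.congr_fun (hw.hasFDerivAt.comp w (hB w)).fderiv _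
  have h3 : HasFDerivAt (fun w => fderiv ℝ g (B w) (L' (toModel v)))
      (((fderiv ℝ (fderiv ℝ g) (B (toModel p.2))).comp L').flip (L' (toModel v)))
      (toModel p.2) :=
    (ContinuousLinearMap.apply ℝ ℝ (L' (toModel v))).hasFDerivAt.comp (toModel p.2)
      (hg2.hasFDerivAt.comp (toModel p.2) (hB _))
  rw [hess, h2.fderiv_eq, h3.fderiv, der_chart_gam hp, der_chart_gam hp, ← hBp]
  rfl

theorem hess_comm {f : TB n M → ℝ} {p : TB n M} (hf : FunSmoothAt f p)
    (u v : TangentSpace (𝓡 n) p.1) : hess f p u v = hess f p v u := by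
  have hs : IsSymmSndFDerivAt ℝ (f ∘ (extChartAt (𝓡 n).tangent p).symm)
      (extChartAt (𝓡 n).tangent p p) :=
    (contDiffAt_comp_chart_symm (mem_chart_source _ p) hf).isSymmSndFDerivAt
      (by rw [minSmoothness_of_isRCLikeNormedField]; exact two_le_infty)
  rw [hess_eq hf, hess_eq hf]
  exact hs.eq _ _

theorem hess_add_left (f : TB n M → ℝ) (p : TB n M) (u u' v : TangentSpace (𝓡 n) p.1) :
    hess f p (u + u') v = hess f p u v + hess f p u' v :=
  map_add (fderiv ℝ (fun w : V n => fderiv ℝ (fun w' : V n => f (incl p.1 w')) w (toModel v))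
    (toModel p.2)) _ _

theorem hess_smul_left (f : TB n M → ℝ) (p : TB n M) (t : ℝ) (u v : TangentSpace (𝓡 n) p.1) :
    hess f p (t • u) v = t * hess f p u v :=
  map_smul (fderiv ℝ (fun w : V n => fderiv ℝ (fun w' : V n => f (incl p.1 w')) w (toModel v))
    (toModel p.2)) _ _

/-- The fibre Hessian in terms of Lie derivatives: `W (J X f) - J [W, X] f` for `W` vertical. -/
theorem hess_lie {f : TB n M → ℝ} {W X : Field n M} {p : TB n M} (hf : FunSmoothAt f p)
    (hW : W.SmoothAt p) (hX : X.SmoothAt p) (hWv : ∀ᶠ q in nhds p, J W q = 0)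
    {u : TangentSpace (𝓡 n) p.1} (hu : W p = gam p u) :
    dfun (lie (J X) f) p (W p) - dfun f p (J (bracket W X) p) = hess f p u (rho p (X p)) := by
  have hp := mem_chart_source (V n) p.1
  have hp' := mem_chart_source (ModelProd (V n) (V n)) p
  have h1 : shift n (der (𝓡 n).tangent (coord p W) p (X p)) = 0 := by
    rw [← der_coord_J hp hW, der_congr (g := fun _ => 0)
      (hWv.mono fun q hq => by rw [coord, hq, map_zero]), der_const]
    rfl
  have h2 : dfun (lie (J X) f) p (W p) = _ := der_der hp' (hX.J.coord hp) hf (W p)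
  have h3 : dfun f p (J (bracket W X) p) = _ :=
    der_eq_fderiv_chart hp' hf.mdifferentiableAt (J (bracket W X) p)
  have h4 : der (𝓡 n).tangent (extChartAt (𝓡 n).tangent p) p (J (bracket W X) p) =
      der (𝓡 n).tangent (coord p (J X)) p (W p) := by
    refine (coord_J hp (bracket W X)).trans ?_
    rw [coord_bracket hp hW hX, map_sub, h1, sub_zero, der_coord_J hp hX]
  rw [h2, h3, h4, hess_eq hf, add_sub_cancel_right, hu]
  rfl

/-- A vector field with prescribed smooth components in a chart. -/
theorem exists_coord_eq (c : TB n M) (w : TB n M → V n × V n) :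
    ∃ X : Field n M, ∀ q : TB n M, q.1 ∈ (chartAt (V n) c.1).source → coord c X q = w q :=
  ⟨fun q => (der (𝓡 n).tangent (extChartAt (𝓡 n).tangent c) q).inverse (w q), fun q hq =>
    (isInvertible_der_chart (I := (𝓡 n).tangent) (mem_chart_iff.2 hq)).self_apply_inverse (w q)⟩

/-- Every smooth `π`-vector field is locally `ρ Y` for a smooth vector field `Y`. -/
theorem exists_rho_eq {ψ : PiField n M} {U : Set (TB n M)} (hU : IsOpen U) (hψ : ψ.SmoothOn U)
    {p : TB n M} (hp : p ∈ U) :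
    ∃ U' ⊆ U, IsOpen U' ∧ p ∈ U' ∧ ∃ Y : Field n M, Y.SmoothOn U' ∧
      ∀ q ∈ U', rho q (Y q) = ψ q := by
  let S : Set (TB n M) := (chartAt (ModelProd (V n) (V n)) p).source
  have hS : IsOpen S := (chartAt (ModelProd (V n) (V n)) p).open_source
  obtain ⟨Y, hY⟩ := exists_coord_eq p
    fun q => ((extChartAt (𝓡 n).tangent p (⟨q.1, ψ q⟩ : TB n M)).2, 0)
  have hYs : ∀ q ∈ U ∩ S, Y.SmoothAt q := by
    intro q hq
    have hq1 := mem_chart_iff.1 hq.2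
    rw [Field.smoothAt_iff hq1]
    have h1 := (contMDiffAt_extChartAt' (I := (𝓡 n).tangent) (n := ∞) (x := p)
      (x' := (⟨q.1, ψ q⟩ : TB n M)) (mem_chart_iff.2 hq1)).comp q
      (hψ.contMDiffAt (hU.mem_nhds hq.1))
    have h2 := ((ContinuousLinearMap.inl ℝ (V n) (V n)).comp
      (ContinuousLinearMap.snd ℝ (V n) (V n))).contDiff (n := ∞)
    exact (h2.contMDiff.contMDiffAt.comp q h1).congr_of_eventuallyEq
      ((eventually_mem_chart hq1).mono fun z hz => hY z hz)
  refine ⟨U ∩ S, Set.inter_subset_left, hU.inter hS, ⟨hp, mem_chart_source _ p⟩, Y,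
    Field.smoothOn_of_smoothAt hYs, fun q hq => ?_⟩
  have hq1 := mem_chart_iff.1 hq.2
  apply (isInvertible_der_chart (I := 𝓡 n) hq1).injective
  rw [← der_chart_fst hq1]
  refine (congrArg Prod.fst (hY q hq1)).trans ?_
  exact congrArg Prod.snd (chart_apply (c := p) (q := (⟨q.1, ψ q⟩ : TB n M)) hq1)

/-- Every tangent vector of `M` is the value of `ρ X` for a smooth local vector field `X`. -/
theorem exists_rho_apply_eq {U : Set (TB n M)} (hU : IsOpen U) {p : TB n M} (hp : p ∈ U)
    (v : TangentSpace (𝓡 n) p.1) :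
    ∃ U' ⊆ U, IsOpen U' ∧ p ∈ U' ∧ ∃ X : Field n M, X.SmoothOn U' ∧ rho p (X p) = v := by
  let S : Set (TB n M) := (chartAt (ModelProd (V n) (V n)) p).source
  have hS : IsOpen S := (chartAt (ModelProd (V n) (V n)) p).open_source
  have hp1 := mem_chart_source (V n) p.1
  obtain ⟨X, hX⟩ := exists_coord_eq p fun _ => (der (𝓡 n) (extChartAt (𝓡 n) p.1) p.1 v, 0)
  have hXs : ∀ q ∈ U ∩ S, X.SmoothAt q := by
    intro q hq
    have hq1 := mem_chart_iff.1 hq.2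
    rw [Field.smoothAt_iff hq1]
    exact contMDiffAt_const.congr_of_eventuallyEq
      ((eventually_mem_chart hq1).mono fun z hz => hX z hz)
  refine ⟨U ∩ S, Set.inter_subset_left, hU.inter hS, ⟨hp, mem_chart_source _ p⟩, X,
    Field.smoothOn_of_smoothAt hXs, ?_⟩
  apply (isInvertible_der_chart (I := 𝓡 n) hp1).injective
  rw [← der_chart_fst hp1]
  exact congrArg Prod.fst (hX p hp1)

end Functions

/-! ### Semisprays and Finsler metrics -/

section Spray

variable {n : ℕ} {M : Type*} [TopologicalSpace M] [ChartedSpace (V n) M] [IsManifold (𝓡 n) ∞ M]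
  {F : TB n M → ℝ} {D U : Set (TB n M)} {G X Y : Field n M} {p : TB n M}

/-- The tangent structure at a point, as a linear endomorphism. -/
noncomputable def Jlin (p : TB n M) :
    TangentSpace (𝓡 n).tangent p →ₗ[ℝ] TangentSpace (𝓡 n).tangent p where
  toFun v := gam p (rho p v)
  map_add' v w := by rw [map_add, gam_add]
  map_smul' t v := by rw [map_smul, gam_smul, RingHom.id_apply]

theorem J_eq (X : Field n M) (p : TB n M) : J X p = Jlin p (X p) := rfl

theorem Jlin_Jlin (p : TB n M) (v : TangentSpace (𝓡 n).tangent p) : Jlin p (Jlin p v) = 0 := by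
  show gam p (rho p (gam p (rho p v))) = 0
  rw [rho_gam, gam_zero]

theorem FunSmoothAt.comp {f : TB n M → ℝ} (hf : FunSmoothAt f p) {h : ℝ → ℝ}
    (hh : ContDiffAt ℝ ∞ h (f p)) : FunSmoothAt (fun q => h (f q)) p :=
  hh.contMDiffAt.comp p hf

theorem FunSmoothAt.mul {f g : TB n M → ℝ} (hf : FunSmoothAt f p) (hg : FunSmoothAt g p) :
    FunSmoothAt (fun q => f q * g q) p :=
  ContMDiffAt.mul hf hg

theorem FunSmoothAt.add {f g : TB n M → ℝ} (hf : FunSmoothAt f p) (hg : FunSmoothAt g p) :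
    FunSmoothAt (fun q => f q + g q) p :=
  ContMDiffAt.add hf hg

theorem FunSmoothAt.congr {f g : TB n M → ℝ} (hf : FunSmoothAt f p) (h : g =ᶠ[nhds p] f) :
    FunSmoothAt g p :=
  ContMDiffAt.congr_of_eventuallyEq hf h

theorem dfun_eq_zero_of_isLocalMin {f : TB n M → ℝ} (hf : FunSmoothAt f p)
    (h : ∀ᶠ q in nhds p, f p ≤ f q) (v : TangentSpace (𝓡 n).tangent p) : dfun f p v = 0 := by
  have hp := mem_chart_source (ModelProd (V n) (V n)) p
  have h1 : IsLocalMin (f ∘ (extChartAt (𝓡 n).tangent p).symm) (extChartAt (𝓡 n).tangent p p) := by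
    have hs := (contMDiffAt_chart_symm (I := (𝓡 n).tangent) hp).continuousAt
    rw [ContinuousAt, extChartAt_to_inv] at hs
    refine (hs.eventually h).mono fun z hz => ?_
    simpa only [Function.comp_apply, extChartAt_to_inv] using hz
  refine (der_eq_fderiv_chart hp hf.mdifferentiableAt v).trans ?_
  rw [h1.fderiv_eq_zero]
  rfl

theorem exists_smoothAt_rho_eq (p : TB n M) (v : TangentSpace (𝓡 n) p.1) :
    ∃ X : Field n M, X.SmoothAt p ∧ rho p (X p) = v := by
  obtain ⟨U, -, hU, hp, X, hX, h⟩ := exists_rho_apply_eq isOpen_univ (Set.mem_univ p) v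
  exact ⟨X, hX.smoothAt hU hp, h⟩

theorem hess_lie_J {f : TB n M → ℝ} (hf : FunSmoothAt f p) (hX : X.SmoothAt p)
    (hY : Y.SmoothAt p) :
    hess f p (rho p (X p)) (rho p (Y p)) =
      dfun (lie (J Y) f) p (J X p) - dfun f p (J (bracket (J X) Y) p) :=
  (hess_lie hf hX.J hY (Filter.Eventually.of_forall fun q => Jlin_Jlin q (X q)) rfl).symm

/-- The defining property of a semispray `G`, in terms of brackets. -/
theorem J_bracket_J_spray (hG : G.SmoothAt p) (h : ∀ᶠ q in nhds p, J G q = liouville q)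
    (hX : X.SmoothAt p) : J (bracket (J X) G) p = J X p := by
  have h1 := bracket_J_J hX hG
  rw [bracket_congr (Filter.EventuallyEq.refl _ (J X)) h, bracket_swap, bracket_liouville_J hX,
    J_eq (bracket X (J G)), bracket_congr (Filter.EventuallyEq.refl _ X) h, bracket_swap X,
    map_neg, ← J_eq] at h1
  rw [neg_sub, sub_eq_add_neg] at h1
  exact (add_right_cancel h1).symm

/-- If `W` is vertical, so is its bracket with any vertical field. -/
theorem J_bracket_J_of_vertical {W : Field n M} (hW : W.SmoothAt p) (hX : X.SmoothAt p)
    (h : ∀ᶠ q in nhds p, J W q = 0) : J (bracket (J X) W) p = 0 := by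
  have h1 := bracket_J_J hX hW
  rw [bracket_eq_zero_of_eventually_right h, J_eq (bracket X (J W)),
    bracket_eq_zero_of_eventually_right h, map_zero, add_zero] at h1
  exact h1.symm

/-- For a `2`-homogeneous `f`, the equation `i_G d d_J f = - df` is the Euler–Lagrange equation. -/
theorem ddJ_spray {f : TB n M → ℝ} (hf : FunSmoothAt f p)
    (h : ∀ᶠ q in nhds p, J G q = liouville q)
    (hhom : ∀ᶠ q in nhds p, dfun f q (liouville q) = 2 * f q) :
    ddJ f G X p = dfun (lie (J X) f) p (G p) - dfun f p (J (bracket G X) p)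
      - 2 * dfun f p (X p) := by
  have h1 : dJ f G =ᶠ[nhds p] fun q => 2 * f q := by
    filter_upwards [h, hhom] with q hq hq'
    rw [dJ, hq, hq']
  rw [ddJ, dfun_congr h1, dfun_const_mul hf]
  show dfun (lie (J X) f) p (G p) - 2 * dfun f p (X p) - dfun f p (J (bracket G X) p) = _
  ring

theorem Field.SmoothAt.hor (hG : G.SmoothAt p) (hX : X.SmoothAt p) :
    (Finsler.hor G X).SmoothAt p :=
  Field.SmoothAt.smul (f := fun _ => (1 / 2 : ℝ)) contMDiffAt_const
    (hX.add ((hX.J.bracket hG).sub (hX.bracket hG).J))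

theorem hor_apply (G X : Field n M) (p : TB n M) :
    hor G X p = (1 / 2 : ℝ) • (X p + (bracket (J X) G p - J (bracket X G) p)) := rfl

theorem hor_add_ver (G X : Field n M) (p : TB n M) : hor G X p + ver G X p = X p := by
  rw [hor, ver, ← smul_add, add_add_sub_cancel, ← two_smul ℝ (X p), smul_smul]
  norm_num

theorem J_hor (hG : G.SmoothAt p) (h : ∀ᶠ q in nhds p, J G q = liouville q)
    (hX : X.SmoothAt p) : J (hor G X) p = J X p := by
  rw [J_eq, hor_apply, map_smul, map_add, map_sub, ← J_eq, ← J_eq, J_bracket_J_spray hG h hX,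
    J_eq (bracket X G), Jlin_Jlin, sub_zero, ← two_smul ℝ (J X p), smul_smul]
  norm_num

theorem IsConicDomain.eventually_mem (hD : IsConicDomain D) (hp : p ∈ D) : ∀ᶠ q in nhds p, q ∈ D :=
  hD.isOpen.mem_nhds hp

theorem IsSpray.eventually_J_eq (hG : IsSpray D G) (hD : IsConicDomain D) (hp : p ∈ D) :
    ∀ᶠ q in nhds p, J G q = liouville q :=
  (hD.eventually_mem hp).mono hG.tangent

theorem IsFinsler.smoothAt (hF : IsFinsler F D) (hp : p ∈ D) : FunSmoothAt F p :=
  hF.smooth.contMDiffAt (hF.domain.isOpen.mem_nhds hp)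

theorem hasDerivAt_half_sq (t : ℝ) : HasDerivAt (fun s : ℝ => s ^ 2 / 2) t t := by
  refine ((hasDerivAt_pow 2 t).div_const 2).congr_deriv ?_
  norm_num

theorem smoothAt_energy (hF : FunSmoothAt F p) : FunSmoothAt (energy F) p :=
  hF.comp (h := fun s => s ^ 2 / 2) ((contDiffAt_id.pow 2).div_const 2)

theorem dfun_energy (hF : FunSmoothAt F p) (v : TangentSpace (𝓡 n).tangent p) :
    dfun (energy F) p v = F p * dfun F p v :=
  dfun_comp hF (hasDerivAt_half_sq _) v

/-- A Finsler metric has no zero: at a zero, which is a minimum, the first and second derivatives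
of `F² / 2` along the fibre vanish, against non-degeneracy. -/
theorem IsFinsler.pos (hF : IsFinsler F D) (hp : p ∈ D) : 0 < F p := by
  refine lt_of_le_of_ne (hF.nonneg p hp) fun h0 => hF.domain.slit p hp ?_
  have hFs := hF.smoothAt hp
  have hd : ∀ v, dfun F p v = 0 := dfun_eq_zero_of_isLocalMin hFs
    ((hF.domain.eventually_mem hp).mono fun q hq => by rw [← h0]; exact hF.nonneg q hq)
  refine hF.nondegenerate p hp _ fun v => ?_
  obtain ⟨X, hX, hXp⟩ := exists_smoothAt_rho_eq p p.2
  obtain ⟨Y, hY, hYp⟩ := exists_smoothAt_rho_eq p v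
  have h1 : metric F p p.2 v = hess (energy F) p (rho p (X p)) (rho p (Y p)) := by
    rw [hXp, hYp]; rfl
  have h2 : lie (J Y) (energy F) =ᶠ[nhds p] fun q => F q * lie (J Y) F q := by
    filter_upwards [hF.domain.eventually_mem hp] with q hq
    exact dfun_energy (hF.smoothAt hq) _
  rw [h1, hess_lie_J (smoothAt_energy hFs) hX hY, dfun_congr h2, dfun_mul hFs (hFs.lie hY.J),
    dfun_energy hFs, hd, hd, ← h0]
  ring

theorem IsFinsler.energy_smoothAt (hF : IsFinsler F D) (hp : p ∈ D) : FunSmoothAt (energy F) p :=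
  smoothAt_energy (hF.smoothAt hp)

theorem dfun_energy_liouville (hF : FunSmoothAt F p) (h : dfun F p (liouville p) = F p) :
    dfun (energy F) p (liouville p) = 2 * energy F p := by
  rw [dfun_energy hF, h, energy]
  ring

theorem rho_spray (h : J G p = liouville p) : rho p (G p) = p.2 :=
  gam_injective p h

theorem IsFinsler.metric_comm (hF : IsFinsler F D) (hp : p ∈ D) (u v : TangentSpace (𝓡 n) p.1) :
    metric F p u v = metric F p v u :=
  hess_comm (hF.energy_smoothAt hp) u v

/-- Contracting the fibre Hessian of a `2`-homogeneous function with the position. -/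
theorem hess_snd {f : TB n M → ℝ} (hf : FunSmoothAt f p) (hG : G.SmoothAt p)
    (h : ∀ᶠ q in nhds p, J G q = liouville q)
    (hhom : ∀ᶠ q in nhds p, dfun f q (liouville q) = 2 * f q) (u : TangentSpace (𝓡 n) p.1) :
    hess f p u p.2 = dfun f p (gam p u) := by
  obtain ⟨X, hX, rfl⟩ := exists_smoothAt_rho_eq p u
  have h1 : lie (J G) f =ᶠ[nhds p] fun q => 2 * f q := by
    filter_upwards [h, hhom] with q hq hq'
    rw [lie, hq, hq']
  rw [← rho_spray h.self_of_nhds, hess_lie_J hf hX hG, dfun_congr h1, dfun_const_mul hf,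
    J_bracket_J_spray hG h hX]
  show 2 * dfun f p (J X p) - dfun f p (J X p) = dfun f p (J X p)
  ring

end Spray

/-! ### Concurrent fields -/

section Concurrent

variable {n : ℕ} {M : Type*} [TopologicalSpace M] [ChartedSpace (V n) M] [IsManifold (𝓡 n) ∞ M]
  {F : TB n M → ℝ} {D U : Set (TB n M)} {G X Y : Field n M} {φ : PiField n M} {p : TB n M}

theorem IsFinsler.energy_homogeneous (hF : IsFinsler F D) (hp : p ∈ D) :
    dfun (energy F) p (liouville p) = 2 * energy F p :=
  dfun_energy_liouville (hF.smoothAt hp) (hF.homogeneous p hp)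

theorem IsGeodesicSpray.smoothAt (hF : IsFinsler F D) (hG : IsGeodesicSpray F D G) (hp : p ∈ D) :
    G.SmoothAt p :=
  hG.smooth.smoothAt hF.domain.isOpen hp

theorem IsGeodesicSpray.eventually_J_eq (hF : IsFinsler F D) (hG : IsGeodesicSpray F D G)
    (hp : p ∈ D) : ∀ᶠ q in nhds p, J G q = liouville q :=
  hG.toIsSpray.eventually_J_eq hF.domain hp

/-- The form `g (·, y)` is the vertical differential of the energy. -/
theorem metric_snd (hF : IsFinsler F D) (hG : IsGeodesicSpray F D G) (hp : p ∈ D)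
    (u : TangentSpace (𝓡 n) p.1) : metric F p u p.2 = dfun (energy F) p (gam p u) :=
  hess_snd (hF.energy_smoothAt hp) (hG.smoothAt hF hp) (hG.eventually_J_eq hF hp)
    ((hF.domain.eventually_mem hp).mono fun _ hq => hF.energy_homogeneous hq) u

theorem metric_snd_snd (hF : IsFinsler F D) (hG : IsGeodesicSpray F D G) (hp : p ∈ D) :
    metric F p p.2 p.2 = 2 * energy F p :=
  (metric_snd hF hG hp p.2).trans (hF.energy_homogeneous hp)

/-- The Euler–Lagrange equation of the energy. -/
theorem euler_lagrange (hF : IsFinsler F D) (hG : IsGeodesicSpray F D G) (hUD : U ⊆ D)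
    (hU : IsOpen U) (hX : X.SmoothOn U) (hp : p ∈ U) :
    dfun (lie (J X) (energy F)) p (G p) - dfun (energy F) p (J (bracket G X) p) =
      dfun (energy F) p (X p) := by
  have h1 := hG.geodesic U hUD hU X hX p hp
  rw [ddJ_spray (hF.energy_smoothAt (hUD hp)) (hG.eventually_J_eq hF (hUD hp))
    ((hF.domain.eventually_mem (hUD hp)).mono fun _ hq => hF.energy_homogeneous hq)] at h1
  linarith

/-- The energy is constant along the geodesics. -/
theorem dfun_energy_spray (hF : IsFinsler F D) (hG : IsGeodesicSpray F D G) (hp : p ∈ D) :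
    dfun (energy F) p (G p) = 0 := by
  have h1 := hG.geodesic D subset_rfl hF.domain.isOpen G hG.smooth p hp
  have h2 : dJ (energy F) (bracket G G) p = 0 := by
    rw [dJ, J_eq, bracket_self, map_zero, dfun_map_zero]
  rw [ddJ, h2] at h1
  linarith

theorem two_mul_dfun_hor {f : TB n M → ℝ} (hf : FunSmoothAt f p) (hG : G.SmoothAt p)
    (hX : X.SmoothAt p) :
    2 * dfun f p (hor G X p) = dfun f p (X p) + (dfun (lie G f) p (J X p) -
      dfun (lie (J X) f) p (G p)) + dfun f p (J (bracket G X) p) := by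
  have h1 : J (bracket X G) p = -J (bracket G X) p := by
    rw [J_eq, bracket_swap, map_neg, ← J_eq]
  rw [hor_apply, dfun_map_smul, dfun_map_add, dfun_map_sub, dfun_bracket hf hX.J hG, h1,
    dfun_map_neg]
  ring

/-- The Barthel connection is conservative: the energy is constant along horizontal vectors. -/
theorem dfun_energy_hor (hF : IsFinsler F D) (hG : IsGeodesicSpray F D G) (hUD : U ⊆ D)
    (hU : IsOpen U) (hX : X.SmoothOn U) (hp : p ∈ U) : dfun (energy F) p (hor G X p) = 0 := by
  have hE := hF.energy_smoothAt (hUD hp)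
  have h1 := two_mul_dfun_hor hE (hG.smoothAt hF (hUD hp)) (hX.smoothAt hU hp)
  have h2 : lie G (energy F) =ᶠ[nhds p] fun _ => 0 :=
    (hF.domain.eventually_mem (hUD hp)).mono fun _ hq => dfun_energy_spray hF hG hq
  rw [dfun_congr h2, dfun_const] at h1
  linarith [euler_lagrange hF hG hUD hU hX hp]

theorem hor_spray (hF : IsFinsler F D) (hG : IsGeodesicSpray F D G) (hp : p ∈ D) :
    hor G G p = G p := by
  rw [hor_apply, J_eq, bracket_self, map_zero, sub_zero,
    bracket_congr (hG.eventually_J_eq hF hp) (Filter.EventuallyEq.refl _ G),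
    hG.homogeneous p hp, ← two_smul ℝ (G p), smul_smul]
  norm_num

theorem hor_smoothOn (hF : IsFinsler F D) (hG : IsGeodesicSpray F D G) (hUD : U ⊆ D)
    (hU : IsOpen U) (hX : X.SmoothOn U) : (hor G X).SmoothOn U :=
  Field.smoothOn_of_smoothAt fun _ hq => Field.SmoothAt.hor (hG.smoothAt hF (hUD hq))
    (hX.smoothAt hU hq)

/-- A field and its horizontal part have the same brackets with vertical fields, up to vertical
ones. -/
theorem J_bracket_J_hor (hF : IsFinsler F D) (hG : IsGeodesicSpray F D G) (hUD : U ⊆ D)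
    (hU : IsOpen U) (hX : X.SmoothOn U) (hY : Y.SmoothOn U) (hp : p ∈ U) :
    J (bracket (J X) (hor G Y)) p = J (bracket (J X) Y) p := by
  have hYh := hor_smoothOn hF hG hUD hU hY
  have h1 : Field.SmoothAt (fun q => hor G Y q - Y q) p :=
    (hYh.smoothAt hU hp).sub (hY.smoothAt hU hp)
  have h2 : ∀ᶠ q in nhds p, J (fun q => hor G Y q - Y q) q = 0 := by
    filter_upwards [hU.mem_nhds hp] with q hq
    rw [J_eq, map_sub, ← J_eq, ← J_eq, J_hor (hG.smoothAt hF (hUD hq))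
      (hG.eventually_J_eq hF (hUD hq)) (hY.smoothAt hU hq), sub_self]
  have h3 : hor G Y = fun q => Y q + (hor G Y q - Y q) := by
    funext q; rw [add_sub_cancel]
  rw [h3, J_eq, bracket_add (hY.smoothAt hU hp) h1, map_add, ← J_eq, ← J_eq,
    J_bracket_J_of_vertical h1 (hX.smoothAt hU hp) h2, add_zero]

/-- A concurrent `π`-vector field does not depend on the direction. -/
theorem IsConcurrent.J_bracket (hF : IsFinsler F D) (hG : IsGeodesicSpray F D G)
    (hφ : IsConcurrent F D G φ) (hUD : U ⊆ D)
    (hU : IsOpen U) (hX : X.SmoothOn U) (hY : Y.SmoothOn U) (hYφ : ∀ q ∈ U, rho q (Y q) = φ q)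
    (hp : p ∈ U) : J (bracket (J X) Y) p = 0 := by
  rw [← J_bracket_J_hor hF hG hUD hU hX hY hp, J_eq_zero_iff]
  exact hφ.vertical U hUD hU X Y hX hY hYφ p hp

theorem Phi_eq (hF : IsFinsler F D) (hG : IsGeodesicSpray F D G) (hp : p ∈ D) :
    Phi F φ p = dfun (energy F) p (gam p (φ p)) :=
  metric_snd hF hG hp (φ p)

theorem Phi_eq_lie (hF : IsFinsler F D) (hG : IsGeodesicSpray F D G) (hUD : U ⊆ D)
    (hYφ : ∀ q ∈ U, rho q (Y q) = φ q) (hp : p ∈ U) :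
    Phi F φ p = lie (J Y) (energy F) p := by
  rw [Phi_eq hF hG (hUD hp), lie, J, hYφ p hp]

theorem IsConcurrent.exists_field (hφ : IsConcurrent F D G φ) (hUD : U ⊆ D)
    (hU : IsOpen U) (hp : p ∈ U) :
    ∃ U' ⊆ U, IsOpen U' ∧ p ∈ U' ∧ ∃ Y : Field n M, Y.SmoothOn U' ∧
      ∀ q ∈ U', rho q (Y q) = φ q :=
  exists_rho_eq hU (ContMDiffOn.mono hφ.smooth hUD) hp

theorem Phi_smoothAt (hF : IsFinsler F D) (hG : IsGeodesicSpray F D G)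
    (hφ : IsConcurrent F D G φ) (hp : p ∈ D) : FunSmoothAt (Phi F φ) p := by
  obtain ⟨U, hUD, hU, hpU, Y, hY, hYφ⟩ := hφ.exists_field subset_rfl hF.domain.isOpen hp
  refine ((hF.energy_smoothAt hp).lie (hY.smoothAt hU hpU).J).congr ?_
  filter_upwards [hU.mem_nhds hpU] with q hq using Phi_eq_lie hF hG hUD hYφ hq

/-- The horizontal derivative of `Φ` is minus the corresponding vertical derivative of the energy:
as `dE` vanishes on horizontal vectors, `(h X) (S E) = [h X, S] E = dE (v [h X, S])` for `S = γ φ`,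
and `v [h X, S] = - J X`. -/
theorem dfun_Phi_hor (hF : IsFinsler F D) (hG : IsGeodesicSpray F D G)
    (hφ : IsConcurrent F D G φ) (hUD : U ⊆ D) (hU : IsOpen U) (hX : X.SmoothOn U) (hp : p ∈ U) :
    dfun (Phi F φ) p (hor G X p) = -dfun (energy F) p (J X p) := by
  obtain ⟨U', hU'U, hU', hpU', Y, hY, hYφ⟩ := hφ.exists_field hUD hU hp
  have hU'D := hU'U.trans hUD
  have hX' := hX.mono hU'U
  have hE := hF.energy_smoothAt (hUD hp)
  have hYs := hY.smoothAt hU' hpU'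
  have hh := hor_smoothOn hF hG hU'D hU' hX'
  have hhs := hh.smoothAt hU' hpU'
  have h1 : Phi F φ =ᶠ[nhds p] lie (J Y) (energy F) := by
    filter_upwards [hU'.mem_nhds hpU'] with q hq using Phi_eq_lie hF hG hU'D hYφ hq
  have h2 : lie (hor G X) (energy F) =ᶠ[nhds p] fun _ => 0 := by
    filter_upwards [hU'.mem_nhds hpU'] with q hq using dfun_energy_hor hF hG hU'D hU' hX' hq
  have h3 := dfun_bracket hE hhs hYs.J
  rw [dfun_congr h2, dfun_const, sub_zero] at h3
  have hb : (bracket (hor G X) (J Y)).SmoothOn U' := Field.smoothOn_of_smoothAt fun q hq =>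
    (hh.smoothAt hU' hq).bracket (hY.smoothAt hU' hq).J
  have h4 := dfun_energy_hor hF hG hU'D hU' hb hpU'
  have h5 : ver G (bracket (hor G X) (J Y)) p = -J X p :=
    hφ.horizontal U' hU'D hU' X Y hX' hY hYφ p hpU'
  rw [dfun_congr h1, ← h3, ← hor_add_ver G (bracket (hor G X) (J Y)) p, dfun_map_add, h4, h5,
    dfun_map_neg, zero_add]

theorem dfun_Phi_spray (hF : IsFinsler F D) (hG : IsGeodesicSpray F D G)
    (hφ : IsConcurrent F D G φ) (hp : p ∈ D) :
    dfun (Phi F φ) p (G p) = -(2 * energy F p) := by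
  have h := dfun_Phi_hor hF hG hφ subset_rfl hF.domain.isOpen hG.smooth hp
  rwa [hor_spray hF hG hp, hG.tangent p hp, hF.energy_homogeneous hp] at h

/-- `Φ` also satisfies the Euler–Lagrange equation: `g(φ, ·)` is a closed form on `M`. -/
theorem euler_lagrange_Phi (hF : IsFinsler F D) (hG : IsGeodesicSpray F D G)
    (hφ : IsConcurrent F D G φ) (hUD : U ⊆ D) (hU : IsOpen U) (hX : X.SmoothOn U) (hp : p ∈ U) :
    dfun (lie (J X) (Phi F φ)) p (G p) - dfun (Phi F φ) p (J (bracket G X) p) =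
      dfun (Phi F φ) p (X p) := by
  have hE := hF.energy_smoothAt (hUD hp)
  have h1 := two_mul_dfun_hor (Phi_smoothAt hF hG hφ (hUD hp)) (hG.smoothAt hF (hUD hp))
    (hX.smoothAt hU hp)
  have h2 : lie G (Phi F φ) =ᶠ[nhds p] fun q => (-2) * energy F q := by
    filter_upwards [hF.domain.eventually_mem (hUD hp)] with q hq
    rw [lie, dfun_Phi_spray hF hG hφ hq]
    ring
  rw [dfun_congr h2, dfun_const_mul hE, dfun_Phi_hor hF hG hφ hUD hU hX hp] at h1
  linarith

/-- The form `g (φ, ·)` is the vertical differential of `Φ`, since `φ` does not depend on the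
direction. -/
theorem metric_eq_dfun_Phi (hF : IsFinsler F D) (hG : IsGeodesicSpray F D G)
    (hφ : IsConcurrent F D G φ) (hp : p ∈ D) (v : TangentSpace (𝓡 n) p.1) :
    metric F p (φ p) v = dfun (Phi F φ) p (gam p v) := by
  obtain ⟨U, hUD, hU, hpU, Y, hY, hYφ⟩ := hφ.exists_field subset_rfl hF.domain.isOpen hp
  obtain ⟨U', hU'U, hU', hpU', X, hX, rfl⟩ := exists_rho_apply_eq hU hpU v
  have h1 : Phi F φ =ᶠ[nhds p] lie (J Y) (energy F) := by
    filter_upwards [hU.mem_nhds hpU] with q hq using Phi_eq_lie hF hG hUD hYφ hq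
  rw [hF.metric_comm hp, ← hYφ p hpU]
  refine (hess_lie_J (hF.energy_smoothAt hp) (hX.smoothAt hU' hpU') (hY.smoothAt hU hpU)).trans ?_
  rw [hφ.J_bracket hF hG (hU'U.trans hUD) hU' hX (hY.mono hU'U) (fun q hq => hYφ q (hU'U hq)) hpU',
    dfun_map_zero, sub_zero, dfun_congr h1]
  rfl

/-- `Φ` is linear on the fibres. -/
theorem hess_Phi (hF : IsFinsler F D) (hG : IsGeodesicSpray F D G)
    (hφ : IsConcurrent F D G φ) (hp : p ∈ D) (u v : TangentSpace (𝓡 n) p.1) :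
    hess (Phi F φ) p u v = 0 := by
  obtain ⟨U, hUD, hU, hpU, X, hX, rfl⟩ := exists_rho_apply_eq hF.domain.isOpen hp u
  obtain ⟨U', hU'U, hU', hpU', Y, hY, rfl⟩ := exists_rho_apply_eq hU hpU v
  have hU'D := hU'U.trans hUD
  have hX' := hX.mono hU'U
  rw [hess_lie_J (Phi_smoothAt hF hG hφ hp) (hX.smoothAt hU hpU) (hY.smoothAt hU' hpU')]
  have h1 := hφ.vertical_form U' hU'D hU' X Y hX' hY p hpU'
  have h2 : (fun q => metric F q (φ q) (rho q (Y q))) =ᶠ[nhds p] lie (J Y) (Phi F φ) := by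
    filter_upwards [hU'.mem_nhds hpU'] with q hq
    exact metric_eq_dfun_Phi hF hG hφ (hU'D hq) _
  rw [dfun_congr h2, metric_eq_dfun_Phi hF hG hφ hp] at h1
  have h3 : gam p (berwaldV G X Y p) = J (bracket (J X) Y) p :=
    J_bracket_J_hor hF hG hU'D hU' hX' hY hpU'
  rwa [h3] at h1

end Concurrent

/-! ### Euler's relation -/

section Homogeneous

variable {n : ℕ} {M : Type*} [TopologicalSpace M] [ChartedSpace (V n) M] [IsManifold (𝓡 n) ∞ M]
  {f g : TB n M → ℝ} {p : TB n M} {a b : ℝ}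

/-- A smooth function `f` satisfying Euler's relation `𝒞 f = a f` at `p`. -/
structure EulerAt (f : TB n M → ℝ) (a : ℝ) (p : TB n M) : Prop where
  smoothAt : FunSmoothAt f p
  dfun_liouville : dfun f p (liouville p) = a * f p

theorem EulerAt.mul (hf : EulerAt f a p) (hg : EulerAt g b p) :
    EulerAt (fun q => f q * g q) (a + b) p where
  smoothAt := hf.smoothAt.mul hg.smoothAt
  dfun_liouville := by
    rw [dfun_mul hf.smoothAt hg.smoothAt, hf.dfun_liouville, hg.dfun_liouville]
    ring

theorem EulerAt.const_mul (hf : EulerAt f a p) (t : ℝ) : EulerAt (fun q => t * f q) a p where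
  smoothAt := FunSmoothAt.mul contMDiffAt_const hf.smoothAt
  dfun_liouville := by
    rw [dfun_const_mul hf.smoothAt, hf.dfun_liouville]
    ring

theorem EulerAt.add (hf : EulerAt f a p) (hg : EulerAt g a p) :
    EulerAt (fun q => f q + g q) a p where
  smoothAt := hf.smoothAt.add hg.smoothAt
  dfun_liouville := by
    rw [dfun_add hf.smoothAt hg.smoothAt, hf.dfun_liouville, hg.dfun_liouville]
    ring

theorem EulerAt.inv (hf : EulerAt f a p) (h : f p ≠ 0) : EulerAt (fun q => (f q)⁻¹) (-a) p where
  smoothAt := hf.smoothAt.comp (contDiffAt_inv ℝ h)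
  dfun_liouville := by
    rw [dfun_comp hf.smoothAt (hasDerivAt_inv h), hf.dfun_liouville]
    field_simp

theorem EulerAt.congr (hf : EulerAt f a p) (h : g =ᶠ[nhds p] f) : EulerAt g a p where
  smoothAt := hf.smoothAt.congr h
  dfun_liouville := by rw [dfun_congr h, hf.dfun_liouville, h.self_of_nhds]

end Homogeneous

/-! ### The Euler–Lagrange expression -/

section Pairing

variable {n : ℕ} {M : Type*} [TopologicalSpace M] [ChartedSpace (V n) M] [IsManifold (𝓡 n) ∞ M]
  {W X G G' : Field n M} {p : TB n M} {f e k : TB n M → ℝ}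

/-- The bilinear expression `W (J X f) - J [W, X] f`.  For a semispray `W`, its equality with
`X f` is the Euler–Lagrange equation of `f`; for a vertical `W`, it is the fibre Hessian of `f`. -/
noncomputable def lagr (f : TB n M → ℝ) (W X : Field n M) (p : TB n M) : ℝ :=
  dfun (lie (J X) f) p (W p) - dfun f p (J (bracket W X) p)

/-- Adding a vertical field to `W` adds a Hessian to `lagr f W X`. -/
theorem lagr_eq_add_hess (hf : FunSmoothAt f p) (hG : G.SmoothAt p) (hG' : G'.SmoothAt p)
    (hX : X.SmoothAt p) (hJ : ∀ᶠ q in nhds p, J G' q = J G q) {u : TangentSpace (𝓡 n) p.1}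
    (hu : G' p = G p + gam p u) :
    lagr f G' X p = lagr f G X p + hess f p u (rho p (X p)) := by
  have hW := hG'.sub hG
  have h1 : ∀ᶠ q in nhds p, J (fun q => G' q - G q) q = 0 := by
    filter_upwards [hJ] with q hq
    rw [J_eq, map_sub, ← J_eq, ← J_eq, hq, sub_self]
  have hu' : (fun q => G' q - G q) p = gam p u := by
    show G' p - G p = gam p u
    rw [hu, add_sub_cancel_left]
  have h2 := hess_lie hf hW hX h1 hu'
  have h3 : bracket G' X p = bracket G X p + bracket (fun q => G' q - G q) X p := by
    have h4 : G' = fun q => G q + (G' q - G q) := by funext q; rw [add_sub_cancel]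
    rw [bracket_swap G' X, h4, bracket_add hG hW, bracket_swap X, bracket_swap X, neg_add, neg_neg,
      neg_neg]
    simp only [add_sub_cancel_left]
  rw [← h2, lagr, lagr, J_eq (bracket G' X), h3, map_add, ← J_eq, ← J_eq, dfun_map_add, hu,
    dfun_map_add, add_sub_cancel_left]
  ring

/-- The expression `lagr` for a function `k` behaving as `e ^ a * f ^ b`. -/
theorem lagr_of_logDeriv {a b : ℝ} (he : FunSmoothAt e p) (hf : FunSmoothAt f p)
    (hk : FunSmoothAt k p) (he0 : e p ≠ 0) (hf0 : f p ≠ 0)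
    (h : ∀ᶠ q in nhds p, ∀ v, dfun k q v = k q * (a * (dfun e q v * (e q)⁻¹)
      + b * (dfun f q v * (f q)⁻¹)))
    (hX : X.SmoothAt p) :
    lagr k W X p = k p * ((a * dfun e p (W p) / e p + b * dfun f p (W p) / f p) *
        (a * dfun e p (J X p) / e p + b * dfun f p (J X p) / f p)
      + a * lagr e W X p / e p - a * dfun e p (J X p) * dfun e p (W p) / e p ^ 2
      + b * lagr f W X p / f p - b * dfun f p (J X p) * dfun f p (W p) / f p ^ 2) := by
  have h1 : lie (J X) k =ᶠ[nhds p] fun q => k q * (a * (lie (J X) e q * (e q)⁻¹)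
      + b * (lie (J X) f q * (f q)⁻¹)) := h.mono fun q hq => hq _
  have he' : FunSmoothAt (fun q => (e q)⁻¹) p := he.comp (contDiffAt_inv ℝ he0)
  have hf' : FunSmoothAt (fun q => (f q)⁻¹) p := hf.comp (contDiffAt_inv ℝ hf0)
  have hXe := he.lie hX.J
  have hXf := hf.lie hX.J
  have h2 : FunSmoothAt (fun q => a * (lie (J X) e q * (e q)⁻¹)) p :=
    FunSmoothAt.mul contMDiffAt_const (hXe.mul he')
  have h3 : FunSmoothAt (fun q => b * (lie (J X) f q * (f q)⁻¹)) p :=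
    FunSmoothAt.mul contMDiffAt_const (hXf.mul hf')
  rw [lagr, lagr, lagr, dfun_congr h1, dfun_mul hk (h2.add h3), dfun_add h2 h3,
    dfun_const_mul (hXe.mul he'), dfun_const_mul (hXf.mul hf'), dfun_mul hXe he', dfun_mul hXf hf',
    dfun_comp he (hasDerivAt_inv he0), dfun_comp hf (hasDerivAt_inv hf0), h.self_of_nhds,
    h.self_of_nhds, lie_apply, lie_apply]
  field_simp
  ring

end Pairing

/-! ### The linear system at a point -/

section Algebra

/-- The linear system for the vertical vector `u` by which the changed spray differs from the
original one, in a vector space with a non-degenerate symmetric bilinear form `g`. -/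
theorem linear_system_iff {T : Type*} [AddCommGroup T] [Module ℝ T] (g : T → T → ℝ)
    (hadd : ∀ u v w, g (u + v) w = g u w + g v w) (hsmul : ∀ (t : ℝ) u v, g (t • u) v = t * g u v)
    (hcomm : ∀ u v, g u v = g v u) (hnd : ∀ u, (∀ v, g u v = 0) → u = 0)
    {y z u : T} {E Φ L m Δ : ℝ} (hyy : g y y = 2 * E) (hzy : g z y = Φ) (hzz : g z z = L)
    (hE : E ≠ 0) (hΦ : Φ ≠ 0) (hm : m + 1 ≠ 0) (hΔ : Δ = 2 * m * E * L - (m - 1) * Φ ^ 2)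
    (hΔ0 : Δ ≠ 0) :
    (∀ v, ((m + 1) * g u y / E + -2 * m * (g u z - 2 * E) / Φ) *
        ((m + 1) * g y v / E + -2 * m * g z v / Φ)
      + (m + 1) * g u v / E - (m + 1) * g y v * g u y / E ^ 2
      - -2 * m * g z v * (g u z - 2 * E) / Φ ^ 2 = 0) ↔
      u = (-(4 * m * Φ * E / Δ)) • y + (4 * m * E ^ 2 / Δ) • z := by
  have hyz : g y z = Φ := by rw [hcomm, hzy]
  constructor
  · intro h
    -- For `v = y` the homogeneity makes the system collapse to a single product.
    have h1 : (m + 1) * g u y / E = 2 * m * (g u z - 2 * E) / Φ := by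
      have := h y
      rw [hyy, hzy] at this
      field_simp at this ⊢
      linear_combination this
    -- So `g (u, v)` depends on the unknown `u` only through `g (u, z)`, which `v = z` determines.
    have h2 : ∀ v, (m + 1) * g u v = 2 * m * (g u z - 2 * E) / Φ * g y v
        - 2 * m * E * g z v * (g u z - 2 * E) / Φ ^ 2 := by
      intro v
      have h3 := h v
      have h4 : (m + 1) * g u y / E + -2 * m * (g u z - 2 * E) / Φ = 0 := by rw [h1]; ring
      have h5 : (m + 1) * g y v * g u y / E ^ 2 = g y v / E * ((m + 1) * g u y / E) := by
        field_simp
      rw [h4, h5, h1] at h3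
      field_simp at h3 ⊢
      linear_combination h3
    have h6 : (g u z - 2 * E) * Δ = -2 * (m + 1) * E * Φ ^ 2 := by
      have h7 := h2 z
      rw [hyz, hzz] at h7
      rw [hΔ]
      field_simp at h7
      linear_combination h7
    have h8 : g u z - 2 * E = -2 * (m + 1) * E * Φ ^ 2 / Δ := by
      rw [eq_div_iff hΔ0, h6]
    have h9 : ∀ v, g u v = -(4 * m * Φ * E / Δ) * g y v + 4 * m * E ^ 2 / Δ * g z v := by
      intro v
      have h10 := h2 v
      rw [h8] at h10
      apply mul_left_cancel₀ hm
      rw [h10]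
      field_simp
      ring
    refine sub_eq_zero.1 (hnd _ fun v => ?_)
    rw [sub_eq_add_neg, ← neg_one_smul ℝ, hadd, hsmul, hadd, hsmul, hsmul, h9 v]
    ring
  · rintro rfl v
    simp only [hadd, hsmul, hyy, hzy, hyz, hzz]
    have hL : 2 * m * E * L = Δ + (m - 1) * Φ ^ 2 := by rw [hΔ]; ring
    have hL' : 4 * m * E ^ 2 / Δ * L = 2 * E * (Δ + (m - 1) * Φ ^ 2) / Δ := by
      rw [← hL]; ring
    rw [hL']
    field_simp
    ring

end Algebra

/-! ### The Kropina change -/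

section Kropina

variable {n : ℕ} {M : Type*} [TopologicalSpace M] [ChartedSpace (V n) M] [IsManifold (𝓡 n) ∞ M]
  {F : TB n M → ℝ} {D D' U : Set (TB n M)} {G G' X Y : Field n M} {φ : PiField n M} {p : TB n M}
  {m : ℝ}

theorem dfun_Phi_liouville (hF : IsFinsler F D) (hG : IsGeodesicSpray F D G)
    (hφ : IsConcurrent F D G φ) (hp : p ∈ D) :
    dfun (Phi F φ) p (liouville p) = Phi F φ p :=
  (metric_eq_dfun_Phi hF hG hφ hp p.2).symm

theorem smoothAt_kropina (hF : FunSmoothAt F p) (hΦ : FunSmoothAt (Phi F φ) p) (hF0 : F p ≠ 0)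
    (hΦ0 : Phi F φ p ≠ 0) : FunSmoothAt (kropina F φ m) p :=
  (hF.comp (h := fun t => t ^ (m + 1)) (Real.contDiffAt_rpow_const_of_ne hF0)).mul
    (hΦ.comp (h := fun t => t ^ (-m)) (Real.contDiffAt_rpow_const_of_ne hΦ0))

/-- The logarithmic derivative of the energy of the Kropina change. -/
theorem dfun_energy_kropina (hF : FunSmoothAt F p) (hΦ : FunSmoothAt (Phi F φ) p) (hF0 : F p ≠ 0)
    (hΦ0 : Phi F φ p ≠ 0) (v : TangentSpace (𝓡 n).tangent p) :
    dfun (energy (kropina F φ m)) p v = energy (kropina F φ m) p *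
      ((m + 1) * (dfun (energy F) p v * (energy F p)⁻¹)
        + -2 * m * (dfun (Phi F φ) p v * (Phi F φ p)⁻¹)) := by
  have h1 : dfun (kropina F φ m) p v = _ :=
    dfun_mul (hF.comp (h := fun t => t ^ (m + 1)) (Real.contDiffAt_rpow_const_of_ne hF0))
      (hΦ.comp (h := fun t => t ^ (-m)) (Real.contDiffAt_rpow_const_of_ne hΦ0)) v
  rw [dfun_comp hF (Real.hasDerivAt_rpow_const (Or.inl hF0)),
    dfun_comp hΦ (Real.hasDerivAt_rpow_const (Or.inl hΦ0)), Real.rpow_sub_one hF0,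
    Real.rpow_sub_one hΦ0] at h1
  rw [dfun_energy (smoothAt_kropina hF hΦ hF0 hΦ0), dfun_energy hF, h1]
  simp only [energy, kropina]
  field_simp

/-- For a negative `Φ` the exponent has to be an integer: otherwise the real power, which is
`|Φ| ^ (-m) * cos (m π)` there, could vanish. -/
theorem kropina_ne_zero (hF : 0 < F p)
    (hΦ : 0 < Phi F φ p ∨ ((∃ k : ℤ, m = k) ∧ Phi F φ p ≠ 0)) : kropina F φ m p ≠ 0 := by
  refine mul_ne_zero (Real.rpow_pos_of_pos hF _).ne' ?_
  rcases hΦ with h | ⟨⟨k, rfl⟩, h⟩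
  · exact (Real.rpow_pos_of_pos h _).ne'
  · rw [← Int.cast_neg, Real.rpow_intCast]
    exact zpow_ne_zero _ h

/-- The Euler–Lagrange equation of the Kropina change for the semispray `G'`, as a linear equation
for the vertical vector `G' - G`. -/
theorem geodesic_kropina_iff (hF : IsFinsler F D) (hG : IsGeodesicSpray F D G)
    (hφ : IsConcurrent F D G φ) (hUD : U ⊆ D) (hU : IsOpen U) (hX : X.SmoothOn U) (hp : p ∈ U)
    (hΦ : ∀ q ∈ U, 0 < Phi F φ q ∨ ((∃ k : ℤ, m = k) ∧ Phi F φ q ≠ 0))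
    (hG' : G'.SmoothAt p) (hJ : ∀ᶠ q in nhds p, J G' q = liouville q)
    {u : TangentSpace (𝓡 n) p.1} (hu : G' p = G p + gam p u) :
    ddJ (energy (kropina F φ m)) G' X p = -dfun (energy (kropina F φ m)) p (X p) ↔
      ((m + 1) * metric F p u p.2 / energy F p
          + -2 * m * (metric F p u (φ p) - 2 * energy F p) / Phi F φ p) *
        ((m + 1) * metric F p p.2 (rho p (X p)) / energy F p
          + -2 * m * metric F p (φ p) (rho p (X p)) / Phi F φ p)
      + (m + 1) * metric F p u (rho p (X p)) / energy F p
      - (m + 1) * metric F p p.2 (rho p (X p)) * metric F p u p.2 / energy F p ^ 2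
      - -2 * m * metric F p (φ p) (rho p (X p)) * (metric F p u (φ p) - 2 * energy F p)
        / Phi F φ p ^ 2 = 0 := by
  have hpD := hUD hp
  have hF0 : ∀ q ∈ U, F q ≠ 0 := fun q hq => (hF.pos (hUD hq)).ne'
  have hΦ0 : ∀ q ∈ U, Phi F φ q ≠ 0 := fun q hq => (hΦ q hq).elim (fun h => h.ne') fun h => h.2
  have hE0 : ∀ q ∈ U, energy F q ≠ 0 := fun q hq => by
    have := hF0 q hq
    rw [energy]
    positivity
  have hE := hF.energy_smoothAt hpD
  have hΦs := Phi_smoothAt hF hG hφ hpD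
  have hk0 : energy (kropina F φ m) p ≠ 0 := by
    have := kropina_ne_zero (m := m) (hF.pos hpD) (hΦ p hp)
    rw [energy]
    positivity
  have hk : ∀ᶠ q in nhds p, ∀ v, dfun (energy (kropina F φ m)) q v =
      energy (kropina F φ m) q * ((m + 1) * (dfun (energy F) q v * (energy F q)⁻¹)
        + -2 * m * (dfun (Phi F φ) q v * (Phi F φ q)⁻¹)) := by
    filter_upwards [hU.mem_nhds hp] with q hq v
    exact dfun_energy_kropina (hF.smoothAt (hUD hq)) (Phi_smoothAt hF hG hφ (hUD hq)) (hF0 q hq)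
      (hΦ0 q hq) v
  have hks : FunSmoothAt (energy (kropina F φ m)) p :=
    smoothAt_energy (smoothAt_kropina (hF.smoothAt hpD) hΦs (hF0 p hp) (hΦ0 p hp))
  have hhom : ∀ᶠ q in nhds p, dfun (energy (kropina F φ m)) q (liouville q) =
      2 * energy (kropina F φ m) q := by
    filter_upwards [hU.mem_nhds hp, hk] with q hq hkq
    have h1 := hE0 q hq
    have h2 := hΦ0 q hq
    rw [hkq, hF.energy_homogeneous (hUD hq), dfun_Phi_liouville hF hG hφ (hUD hq)]
    field_simp
    ring
  have hXs := hX.smoothAt hU hp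
  have hGs := hG.smoothAt hF hpD
  have hJG := hG.eventually_J_eq hF hpD
  have hJJ : ∀ᶠ q in nhds p, J G' q = J G q := by
    filter_upwards [hJ, hJG] with q h1 h2
    rw [h1, h2]
  have h1 : lagr (energy F) G' X p = dfun (energy F) p (X p) + metric F p u (rho p (X p)) := by
    rw [lagr_eq_add_hess hE hGs hG' hXs hJJ hu]
    exact congrArg (· + _) (euler_lagrange hF hG hUD hU hX hp)
  have h2 : lagr (Phi F φ) G' X p = dfun (Phi F φ) p (X p) := by
    rw [lagr_eq_add_hess hΦs hGs hG' hXs hJJ hu, hess_Phi hF hG hφ hpD, add_zero]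
    exact euler_lagrange_Phi hF hG hφ hUD hU hX hp
  have h3 : dfun (energy F) p (G' p) = metric F p u p.2 := by
    rw [hu, dfun_map_add, dfun_energy_spray hF hG hpD, zero_add, metric_snd hF hG hpD]
  have h4 : dfun (Phi F φ) p (G' p) = metric F p u (φ p) - 2 * energy F p := by
    rw [hu, dfun_map_add, dfun_Phi_spray hF hG hφ hpD, ← metric_eq_dfun_Phi hF hG hφ hpD,
      hF.metric_comm hpD]
    ring
  have h5 : dfun (energy F) p (J X p) = metric F p p.2 (rho p (X p)) := by
    rw [hF.metric_comm hpD, metric_snd hF hG hpD]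
    rfl
  have h6 : dfun (Phi F φ) p (J X p) = metric F p (φ p) (rho p (X p)) :=
    (metric_eq_dfun_Phi hF hG hφ hpD _).symm
  have h7 := lagr_of_logDeriv (W := G') hE hΦs hks (hE0 p hp) (hΦ0 p hp) hk hXs
  rw [h1, h2, h3, h4, h5, h6] at h7
  rw [ddJ_spray hks hJ hhom]
  rw [lagr] at h7
  rw [h7, hk.self_of_nhds, ← mul_right_inj' hk0 (c := 0), mul_zero, ← sub_eq_zero]
  refine Eq.congr ?_ rfl
  ring

theorem length_eq (hF : IsFinsler F D) (hG : IsGeodesicSpray F D G)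
    (hφ : IsConcurrent F D G φ) (hp : p ∈ D) :
    length F φ p = dfun (Phi F φ) p (gam p (φ p)) :=
  metric_eq_dfun_Phi hF hG hφ hp (φ p)

/-- The vertical lift of a concurrent field is smooth and homogeneous. -/
theorem gam_concurrent (hF : IsFinsler F D) (hG : IsGeodesicSpray F D G)
    (hφ : IsConcurrent F D G φ) (hp : p ∈ D) :
    Field.SmoothAt (fun q => gam q (φ q)) p ∧
      bracket liouville (fun q => gam q (φ q)) p = -gam p (φ p) := by
  obtain ⟨U, hUD, hU, hpU, Y, hY, hYφ⟩ := hφ.exists_field subset_rfl hF.domain.isOpen hp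
  have h1 : J Y =ᶠ[nhds p] fun q => gam q (φ q) := by
    filter_upwards [hU.mem_nhds hpU] with q hq
    rw [J, hYφ q hq]
  have hYs := hY.smoothAt hU hpU
  refine ⟨hYs.J.congr h1, ?_⟩
  have h2 := hφ.J_bracket hF hG hUD hU (hG.smooth.mono hUD) hY hYφ hpU
  have h3 : J (bracket liouville Y) p = 0 := by
    rw [J_eq, ← bracket_congr (hG.eventually_J_eq hF hp) (Filter.EventuallyEq.refl _ Y)]
    exact h2
  rw [← bracket_congr (Filter.EventuallyEq.refl _ liouville) h1, bracket_liouville_J hYs, h3,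
    zero_sub, h1.self_of_nhds]

theorem eulerAt_F (hF : IsFinsler F D) (hp : p ∈ D) : EulerAt F 1 p :=
  ⟨hF.smoothAt hp, by rw [hF.homogeneous p hp, one_mul]⟩

theorem eulerAt_Phi (hF : IsFinsler F D) (hG : IsGeodesicSpray F D G)
    (hφ : IsConcurrent F D G φ) (hp : p ∈ D) : EulerAt (Phi F φ) 1 p :=
  ⟨Phi_smoothAt hF hG hφ hp, by rw [dfun_Phi_liouville hF hG hφ hp, one_mul]⟩

/-- `g (φ, φ)` is the derivative of the `1`-homogeneous `Φ` along `γ φ`, which is homogeneous of degree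
`-1`. -/
theorem eulerAt_length (hF : IsFinsler F D) (hG : IsGeodesicSpray F D G)
    (hφ : IsConcurrent F D G φ) (hp : p ∈ D) : EulerAt (length F φ) 0 p := by
  have hS := gam_concurrent hF hG hφ hp
  have hΦ := Phi_smoothAt hF hG hφ hp
  have h1 : length F φ =ᶠ[nhds p] lie (fun q => gam q (φ q)) (Phi F φ) :=
    (hF.domain.eventually_mem hp).mono fun q hq => length_eq hF hG hφ hq
  have h2 : lie liouville (Phi F φ) =ᶠ[nhds p] Phi F φ :=
    (hF.domain.eventually_mem hp).mono fun q hq => dfun_Phi_liouville hF hG hφ hq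
  have h3 := dfun_bracket hΦ (smoothAt_liouville p) hS.1
  rw [hS.2, dfun_congr h2, dfun_map_neg] at h3
  refine ⟨(hΦ.lie hS.1).congr h1, ?_⟩
  rw [dfun_congr h1]
  linarith

theorem eulerAt_denom (hF : IsFinsler F D) (hG : IsGeodesicSpray F D G)
    (hφ : IsConcurrent F D G φ) (hp : p ∈ D) : EulerAt (denom F φ m) 2 p := by
  have hFe := eulerAt_F hF hp
  have hΦe := eulerAt_Phi hF hG hφ hp
  have h1 := (hFe.mul hFe).mul (eulerAt_length hF hG hφ hp)
  have h2 := hΦe.mul hΦe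
  norm_num at h1 h2
  refine ((h1.const_mul m).add (h2.const_mul (-(m - 1)))).congr
    (Filter.Eventually.of_forall fun q => ?_)
  simp only [denom]
  ring

theorem eulerAt_Psi₁ (hF : IsFinsler F D) (hG : IsGeodesicSpray F D G)
    (hφ : IsConcurrent F D G φ) (hp : p ∈ D) (h : denom F φ m p ≠ 0) :
    EulerAt (Psi₁ F φ m) 1 p := by
  have hFe := eulerAt_F hF hp
  have h1 := ((eulerAt_Phi hF hG hφ hp).mul (hFe.mul hFe)).mul
    ((eulerAt_denom (m := m) hF hG hφ hp).inv h)
  norm_num at h1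
  refine (h1.const_mul (2 * m)).congr (Filter.Eventually.of_forall fun q => ?_)
  simp only [Psi₁, div_eq_mul_inv]
  ring

theorem eulerAt_Psi₂ (hF : IsFinsler F D) (hG : IsGeodesicSpray F D G)
    (hφ : IsConcurrent F D G φ) (hp : p ∈ D) (h : denom F φ m p ≠ 0) :
    EulerAt (Psi₂ F φ m) 2 p := by
  have hFe := eulerAt_F hF hp
  have h1 := ((hFe.mul hFe).mul (hFe.mul hFe)).mul
    ((eulerAt_denom (m := m) hF hG hφ hp).inv h)
  norm_num at h1
  refine (h1.const_mul m).congr (Filter.Eventually.of_forall fun q => ?_)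
  simp only [Psi₂, div_eq_mul_inv]
  ring

/-- The geodesic spray of the Kropina change, `G - Ψ₁ 𝒞 + Ψ₂ γ φ`. -/
noncomputable def changedSpray (F : TB n M → ℝ) (G : Field n M) (φ : PiField n M) (m : ℝ) :
    Field n M := fun p =>
  G p - Psi₁ F φ m p • liouville p + Psi₂ F φ m p • gam p (φ p)

theorem changedSpray_eq (F : TB n M → ℝ) (G : Field n M) (φ : PiField n M) (m : ℝ) (p : TB n M) :
    changedSpray F G φ m p = G p + gam p (-Psi₁ F φ m p • p.2 + Psi₂ F φ m p • φ p) := by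
  rw [changedSpray, gam_add, gam_smul, gam_smul, neg_smul, sub_eq_add_neg, add_assoc]
  rfl

theorem J_changedSpray (h : J G p = liouville p) : J (changedSpray F G φ m) p = liouville p := by
  rw [J, changedSpray_eq, map_add, rho_gam, add_zero]
  exact h

theorem changedSpray_smoothAt (hF : IsFinsler F D) (hG : IsGeodesicSpray F D G)
    (hφ : IsConcurrent F D G φ) (hp : p ∈ D) (h : denom F φ m p ≠ 0) :
    (changedSpray F G φ m).SmoothAt p :=
  ((hG.smoothAt hF hp).sub (Field.SmoothAt.smul (eulerAt_Psi₁ hF hG hφ hp h).smoothAt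
    (smoothAt_liouville p))).add (Field.SmoothAt.smul (eulerAt_Psi₂ hF hG hφ hp h).smoothAt
    (gam_concurrent hF hG hφ hp).1)

theorem bracket_liouville_changedSpray (hF : IsFinsler F D) (hG : IsGeodesicSpray F D G)
    (hφ : IsConcurrent F D G φ) (hp : p ∈ D) (h : denom F φ m p ≠ 0) :
    bracket liouville (changedSpray F G φ m) p = changedSpray F G φ m p := by
  have hG' := hG.smoothAt hF hp
  have h1 := eulerAt_Psi₁ hF hG hφ hp h
  have h2 := eulerAt_Psi₂ hF hG hφ hp h
  have hS := gam_concurrent hF hG hφ hp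
  have hC := smoothAt_liouville p
  have h1' := h1.const_mul (-1)
  have e : changedSpray F G φ m = fun q => (G q + (-1 * Psi₁ F φ m q) • liouville q)
      + Psi₂ F φ m q • gam q (φ q) := by
    funext q
    rw [changedSpray, neg_one_mul, neg_smul, sub_eq_add_neg]
  rw [e, bracket_add (hG'.add (Field.SmoothAt.smul h1'.smoothAt hC))
      (Field.SmoothAt.smul h2.smoothAt hS.1),
    bracket_add hG' (Field.SmoothAt.smul h1'.smoothAt hC), bracket_smul h1'.smoothAt hC,
    bracket_smul h2.smoothAt hS.1, hS.2, bracket_self, hG.homogeneous p hp, h1'.dfun_liouville,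
    h2.dfun_liouville]
  module

end Kropina

end Finsler

theorem theorem2 (n : ℕ) (M : Type*) [TopologicalSpace M]
    [ChartedSpace (EuclideanSpace ℝ (Fin n)) M] [IsManifold (𝓡 n) ∞ M]
    (F : Finsler.TB n M → ℝ) (D : Set (Finsler.TB n M)) (hF : Finsler.IsFinsler F D)
    (G : Finsler.Field n M) (hG : Finsler.IsGeodesicSpray F D G)
    (φ : Finsler.PiField n M) (hφ : Finsler.IsConcurrent F D G φ)
    (m : ℝ) (hm0 : m ≠ 0) (hm1 : m ≠ -1)
    (D' : Set (Finsler.TB n M)) (hD' : Finsler.IsConicDomain D') (hDD' : D' ⊆ D)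
    (hΦ : ∀ p ∈ D', 0 < Finsler.Phi F φ p ∨ ((∃ k : ℤ, m = k) ∧ Finsler.Phi F φ p ≠ 0))
    (hden : ∀ p ∈ D', Finsler.denom F φ m p ≠ 0)
    (G' : Finsler.Field n M) :
    Finsler.IsGeodesicSpray (Finsler.kropina F φ m) D' G' ↔
      ∀ p ∈ D', G' p = G p - Finsler.Psi₁ F φ m p • Finsler.liouville p
        + Finsler.Psi₂ F φ m p • Finsler.gam p (φ p) := by
  open Finsler in
  have hsys : ∀ p ∈ D', ∀ u : TangentSpace (𝓡 n) p.1, (∀ v : TangentSpace (𝓡 n) p.1,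
      ((m + 1) * metric F p u p.2 / energy F p
          + -2 * m * (metric F p u (φ p) - 2 * energy F p) / Phi F φ p) *
        ((m + 1) * metric F p p.2 v / energy F p + -2 * m * metric F p (φ p) v / Phi F φ p)
      + (m + 1) * metric F p u v / energy F p
      - (m + 1) * metric F p p.2 v * metric F p u p.2 / energy F p ^ 2
      - -2 * m * metric F p (φ p) v * (metric F p u (φ p) - 2 * energy F p)
        / Phi F φ p ^ 2 = 0) ↔ u = -Psi₁ F φ m p • p.2 + Psi₂ F φ m p • φ p := by
    intro p hp u
    have hpD := hDD' hp
    have hF0 := hF.pos hpD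
    have hE0 : energy F p ≠ 0 := by
      rw [energy]
      positivity
    have hΦ0 : Phi F φ p ≠ 0 := (hΦ p hp).elim (fun h => h.ne') fun h => h.2
    have hd : denom F φ m p =
        2 * m * energy F p * length F φ p - (m - 1) * Phi F φ p ^ 2 := by
      rw [denom, energy]
      ring
    have h := linear_system_iff (metric F p) (hess_add_left (energy F) p)
      (hess_smul_left (energy F) p) (hF.metric_comm hpD) (hF.nondegenerate p hpD)
      (y := p.2) (z := φ p) (u := u) (L := length F φ p) (Φ := Phi F φ p)
      (metric_snd_snd hF hG hpD) rfl rfl hE0 hΦ0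
      (fun h => hm1 (eq_neg_of_add_eq_zero_left h)) hd (hden p hp)
    have e1 : Psi₁ F φ m p = 4 * m * Phi F φ p * energy F p / denom F φ m p := by
      rw [Psi₁, energy]
      ring
    have e2 : Psi₂ F φ m p = 4 * m * energy F p ^ 2 / denom F φ m p := by
      rw [Psi₂, energy]
      ring
    rw [h, e1, e2]
  open Finsler in
  constructor
  · intro h p hp
    have hJ := h.toIsSpray.eventually_J_eq hD' hp
    have hv : rho p (G' p - G p) = 0 := by
      rw [map_sub, rho_spray (h.tangent p hp), rho_spray (hG.tangent p (hDD' hp)), sub_self]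
    obtain ⟨u, hu⟩ := exists_gam_eq hv
    have hu' : G' p = G p + gam p u := by rw [hu, add_sub_cancel]
    rw [hu', (hsys p hp u).1 ?_, ← changedSpray_eq]
    · rfl
    intro v
    obtain ⟨U, hUD', hU, hpU, X, hX, rfl⟩ := exists_rho_apply_eq hD'.isOpen hp v
    exact (geodesic_kropina_iff hF hG hφ (hUD'.trans hDD') hU hX hpU
      (fun q hq => hΦ q (hUD' hq)) (h.smooth.smoothAt hD'.isOpen hp) hJ hu').1
      (h.geodesic U hUD' hU X hX p hpU)
  · intro h
    have he : ∀ p ∈ D', changedSpray F G φ m =ᶠ[nhds p] G' := fun p hp =>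
      (hD'.eventually_mem hp).mono fun q hq => (h q hq).symm
    have hs : ∀ p ∈ D', G'.SmoothAt p := fun p hp =>
      (changedSpray_smoothAt hF hG hφ (hDD' hp) (hden p hp)).congr (he p hp)
    have hJ : ∀ p ∈ D', J G' p = liouville p := fun p hp => by
      rw [J_eq, ← (he p hp).self_of_nhds]
      exact J_changedSpray (hG.tangent p (hDD' hp))
    refine ⟨⟨Field.smoothOn_of_smoothAt hs, hJ, fun p hp => ?_⟩, fun U hU hUo X hX p hp => ?_⟩
    · rw [← bracket_congr (Filter.EventuallyEq.refl _ liouville) (he p hp),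
        bracket_liouville_changedSpray hF hG hφ (hDD' hp) (hden p hp), (he p hp).self_of_nhds]
    · have hpD' := hU hp
      refine (geodesic_kropina_iff hF hG hφ (hU.trans hDD') hUo hX hp
        (fun q hq => hΦ q (hU hq)) (hs p hpD')
        ((hD'.eventually_mem hpD').mono hJ)
        ((he p hpD').self_of_nhds.symm.trans (changedSpray_eq F G φ m p))).2 ?_
      exact (hsys p hpD' _).2 rfl _
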